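/- Let $\mathbb D$ be the open unit disk and $\mathbb D^2$ the open unit bidisk in $\mathbb C^2$. For $a>-1$ let $dA_a(z)=\frac{a+1}{\pi}(1-|z|^2)^a\,dx\,dy$ on $\mathbb D$ ($z=x+iy$). Let $\alpha,\beta,\theta,\vartheta$ be real numbers with $\alpha,\beta,\theta,\vartheta>-1$ and $\alpha+\beta+2\theta+2\vartheta+3>0$. Let $A^2_{\alpha,\beta,\theta,\vartheta}(\mathbb D^2)$ be the space of holomorphic functions $f$ on $\mathbb D^2$ with $$\|f\|^2_{\alpha,\beta,\theta,\vartheta}=\int_{\mathbb D^2}|f(z_1,z_2)|^2\,|1-\bar z_2z_1|^{2\vartheta}\,|z_1-z_2|^{2\theta}\,dA_\alpha(z_1)\,dA_\beta(z_2)<+\infty,$$ with the associated inner product. For $N=0,1,2,\dots$ let $\sigma(\alpha,\beta,\theta+N,\vartheta)$ be given by $$\frac1{\sigma(\alpha,\beta,\theta+N,\vartheta)}=\int_{\mathbb D}\int_{\mathbb D}|1-\bar z_2z_1|^{2\vartheta}\,|z_1-z_2|^{2\theta+2N}\,dA_\alpha(z_1)\,dA_\beta(z_2);$$ these integrals are finite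 and positive. Then $A^2_{\alpha,\beta,\theta,\vartheta}(\mathbb D^2)$ is a Hilbert space with bounded point evaluations, and its reproducing kernel $P_{\alpha,\beta,\theta,\vartheta}$ is given, for all $z=(z_1,z_2)$ and $w=(w_1,w_2)$ in $\mathbb D^2$, by the convergent series $$P_{\alpha,\beta,\theta,\vartheta}(z,w)=\sum_{N=0}^{+\infty}\sigma(\alpha,\beta,\theta+N,\vartheta)\,(z_1-z_2)^N(\bar w_1-\bar w_2)^N\int_{\mathbb D}\frac{dA_{\alpha+\beta+2\theta+2\vartheta+2N+2}(\xi)}{[(1-\bar\xi z_1)(1-\bar w_1\xi)]^{\alpha+\theta+\vartheta+N+2}\,[(1-\bar\xi z_2)(1-\bar w_2\xi)]^{\beta+\theta+\vartheta+N+2}},$$ where the powers are principal and the integrals over $\xi$ converge absolutely. -/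

import Mathlib

open MeasureTheory ComplexConjugate

noncomputable section

namespace BidiskBergman

/-- The open unit disk in the complex plane. -/
def disk : Set ℂ := {z | ‖z‖ < 1}

/-- The open unit bidisk in `ℂ × ℂ`. -/
def bidisk : Set (ℂ × ℂ) := {z | ‖z.1‖ < 1 ∧ ‖z.2‖ < 1}

/-- The weighted area measure `(α + 1) (1 - |z|²)^α dx dy / π` on the unit disk. -/
def dA (α : ℝ) : Measure ℂ :=
  (volume.restrict disk).withDensity fun z =>
    ENNReal.ofReal ((α + 1) * (1 - ‖z‖ ^ 2) ^ α / Real.pi)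

/-- The weight `|1 - conj z₂ * z₁|^(2ϑ) * |z₁ - z₂|^(2θ)`. -/
def weight (θ ϑ : ℝ) (z : ℂ × ℂ) : ℝ :=
  ‖1 - conj z.2 * z.1‖ ^ (2 * ϑ) * ‖z.1 - z.2‖ ^ (2 * θ)

/-- The measure `|1 - conj z₂ * z₁|^(2ϑ) * |z₁ - z₂|^(2θ) dA_α(z₁) dA_β(z₂)` on the bidisk. -/
def bidiskMeasure (α β θ ϑ : ℝ) : Measure (ℂ × ℂ) :=
  ((dA α).prod (dA β)).withDensity fun z => ENNReal.ofReal (weight θ ϑ z)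

/-- The weighted Bergman space on the bidisk: the subspace of the weighted `L²` space that consists
of the classes of functions holomorphic in the bidisk. Its norm and inner product are those
of `L²`. -/
def bergmanSpace (α β θ ϑ : ℝ) : Submodule ℂ (Lp ℂ 2 (bidiskMeasure α β θ ϑ)) where
  carrier := {f | ∃ g : ℂ × ℂ → ℂ, DifferentiableOn ℂ g bidisk ∧
    f =ᵐ[bidiskMeasure α β θ ϑ] g}
  zero_mem' := ⟨0, differentiableOn_const 0, Lp.coeFn_zero ℂ 2 (bidiskMeasure α β θ ϑ)⟩
  add_mem' := by
    rintro f₁ f₂ ⟨g₁, hg₁, h₁⟩ ⟨g₂, hg₂, h₂⟩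
    exact ⟨g₁ + g₂, hg₁.add hg₂, (Lp.coeFn_add f₁ f₂).trans (h₁.add h₂)⟩
  smul_mem' := by
    rintro c f ⟨g, hg, h⟩
    exact ⟨c • g, hg.const_smul c, (Lp.coeFn_smul c f).trans (h.const_smul c)⟩

/-- The constant `σ(α, β, θ, ϑ)`: the reciprocal of the total mass
`∫∫ |1 - conj z₂ * z₁|^(2ϑ) * |z₁ - z₂|^(2θ) dA_α(z₁) dA_β(z₂)`. -/
def sigma (α β θ ϑ : ℝ) : ℝ :=
  (∫ z, weight θ ϑ z ∂((dA α).prod (dA β)))⁻¹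

/-- The function of `ξ` that is integrated in the `N`-th term of the kernel expansion; all powers
are principal ones, of numbers in the slit plane. -/
def kernelIntegrand (α β θ ϑ : ℝ) (N : ℕ) (z w : ℂ × ℂ) (ξ : ℂ) : ℂ :=
  1 / (((1 - conj ξ * z.1) * (1 - conj w.1 * ξ)) ^ ((α + θ + ϑ + N + 2 : ℝ) : ℂ) *
    ((1 - conj ξ * z.2) * (1 - conj w.2 * ξ)) ^ ((β + θ + ϑ + N + 2 : ℝ) : ℂ))

/-- The `N`-th term of the kernel expansion. -/
def kernelTerm (α β θ ϑ : ℝ) (N : ℕ) (z w : ℂ × ℂ) : ℂ :=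
  (sigma α β (θ + N) ϑ : ℂ) * (z.1 - z.2) ^ N * (conj w.1 - conj w.2) ^ N *
    ∫ ξ, kernelIntegrand α β θ ϑ N z w ξ ∂(dA (α + β + 2 * θ + 2 * ϑ + 2 * N + 2))

end BidiskBergman

end

noncomputable section

namespace BidiskBergman

open Metric Set Filter Topology
open scoped ENNReal NNReal

/-! ### Measures with densities and maps -/

/-! Write `s = α + β + 2θ + 2ϑ + 2` and let a disk automorphism act on both coordinates at once.
This diagonal action multiplies the weighted measure by a constant times the squared modulus of a
holomorphic function (`bidens_mob`). Moving the point `(ξ, ξ)` to the origin, where rotation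
invariance gives the mean value property, therefore yields the reproducing kernel at `(ξ, ξ)`: it is
`σ` times the product `diagKer` of two powers of Szegő type (`integral_mul_conj_diagKer`). Kernels
at other points are not directly accessible in this way.

On the diagonal `diagKer` becomes `(1 - conj ξ * z) ^ (-(s + 2))`, the reproducing kernel of the
disk space for `dA s` (`diagKer_diag`). Hence restriction to the diagonal is, up to the factor `√σ`,
isometric on the closed span `diagSpace` of the diagonal kernels, and a function in that span is
recovered from its diagonal values by an integral over the disk (`rep_eq_integral`). Applied to the
projection of the kernel at `w`, this gives the term `N = 0` of the series
(`rep_starProjection_ker`).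

The orthogonal complement of `diagSpace` consists of the functions vanishing on the diagonal. Such a
function is divisible by `z₁ - z₂` (`exists_eq_sub_mul`), and the quotient lies, with the same norm,
in the space with `θ + 1` in place of `θ`. Thus `P_θ = term + (z₁ - z₂) conj (w₁ - w₂) P_{θ+1}`
(`rep_ker_eq_add`), and iteration produces the series with a remainder that contains `P_{θ+N}`.

The remainder tends to zero geometrically: `|w₁ - w₂|^N` times the norm of the `N`-th kernel is
bounded, because the terms are nonnegative at `z = w` (`norm_pow_mul_norm_ker_le`), and a function
of norm one that vanishes to order `N` on the diagonal is `O(ρ^N)` at a fixed point, by a Schwarz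
lemma on a slice (`exists_decay`).

Two facts are needed beforehand: the weighted measure is finite (`lintegral_bidens_lt_top`), and
point evaluations are locally uniformly bounded although the weight may vanish or blow up on the
diagonal (`exists_local_bound`). -/

theorem map_withDensity_of_comp_eq {X : Type*} [MeasurableSpace X] {ν : Measure X} {Φ : X → X}
    (hΦ : MeasurePreserving Φ ν ν) {W J : X → ℝ≥0∞} (hW : Measurable W) (hJ : Measurable J)
    (h : ∀ᵐ x ∂ν, W (Φ x) = J x * W x) :
    ((ν.withDensity W).withDensity J).map Φ = ν.withDensity W := by
  rw [← withDensity_mul _ hW hJ]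
  ext s hs
  rw [Measure.map_apply hΦ.measurable hs, withDensity_apply _ (hΦ.measurable hs),
    withDensity_apply _ hs, ← hΦ.setLIntegral_comp_preimage hs hW]
  refine setLIntegral_congr_fun_ae (hΦ.measurable hs) ?_
  filter_upwards [h] with x hx _
  rw [hx, Pi.mul_apply, mul_comm]

theorem measurePreserving_withDensity {X : Type*} [MeasurableSpace X] {ν : Measure X} {Φ : X → X}
    (hΦ : MeasurePreserving Φ ν ν) {W : X → ℝ≥0∞} (hW : Measurable W)
    (h : ∀ᵐ x ∂ν, W (Φ x) = W x) :
    MeasurePreserving Φ (ν.withDensity W) (ν.withDensity W) := by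
  refine ⟨hΦ.measurable, ?_⟩
  have := map_withDensity_of_comp_eq hΦ hW (J := 1) measurable_one (by simpa using h)
  simpa using this

/-! ### The mean value property for rotation invariant measures -/

section MeanValue

variable {E : Type*} [NormedAddCommGroup E] [NormedSpace ℂ E]

theorem circle_mean {F : E → ℂ} {R : ℝ} (hF : DifferentiableOn ℂ F (ball 0 R)) {z : E}
    (hz : z ∈ ball (0 : E) R) :
    ∫ t in (0 : ℝ)..2 * Real.pi, F (circleMap 0 1 t • z) = 2 * Real.pi * F 0 := by
  have h : DiffContOnCl ℂ (fun c : ℂ => F (c • z)) (ball 0 |(1 : ℝ)|) := by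
    refine DifferentiableOn.diffContOnCl_ball (U := closedBall 0 1) ?_ (by simp)
    refine hF.comp (by fun_prop) ?_
    intro c hc
    simp only [mem_closedBall, dist_zero_right, mem_ball] at hc hz ⊢
    rw [norm_smul]
    nlinarith [norm_nonneg z]
  have h2 := h.circleAverage
  simp only [Real.circleAverage_def, zero_smul] at h2
  rw [← h2]
  simp only [Complex.real_smul]
  push_cast
  field_simp

variable [MeasurableSpace E] [BorelSpace E]

/-- The integral is unchanged when `F` is replaced by its rotates; averaging over all rotations and
applying Fubini puts the circle average inside, where `circle_mean` evaluates it as `F 0`. -/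
theorem integral_eq_of_rotation [SecondCountableTopology E] {μ : Measure E} [IsFiniteMeasure μ]
    (hrot : ∀ c : ℂ, ‖c‖ = 1 → MeasurePreserving (fun z : E => c • z) μ μ)
    {R : ℝ} (hU : ∀ᵐ z ∂μ, z ∈ ball (0 : E) R) {F : E → ℂ}
    (hF : DifferentiableOn ℂ F (ball 0 R)) (hi : Integrable F μ) :
    ∫ z, F z ∂μ = μ.real univ * F 0 := by
  -- Nothing is known about `F` off the ball; the cutoff is measurable on all of `E`, so it can be
  -- composed with rotations.
  set G : E → ℂ := (ball (0 : E) R).indicator F with hG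
  have hGF : G =ᵐ[μ] F := by
    filter_upwards [hU] with z hz
    simp [hG, hz]
  have hGm : Measurable G := by
    classical
    rw [hG, ← piecewise_eq_indicator]
    exact hF.continuousOn.measurable_piecewise (g := fun _ => (0 : ℂ))
      continuous_const.continuousOn (isOpen_ball (x := (0 : E)) (ε := R)).measurableSet
  have hGi : Integrable G μ := hi.congr hGF.symm
  set τ : Measure ℝ := volume.restrict (Ioc 0 (2 * Real.pi)) with hτ
  have hcn : ∀ t : ℝ, ‖circleMap 0 1 t‖ = 1 := fun t => by simp
  have hm : Measurable (fun p : ℝ × E => G (circleMap 0 1 p.1 • p.2)) := by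
    refine hGm.comp (Continuous.measurable ?_)
    fun_prop
  have hint : Integrable (Function.uncurry fun (t : ℝ) (z : E) => G (circleMap 0 1 t • z))
      (τ.prod μ) := by
    refine (integrable_prod_iff hm.aestronglyMeasurable).2 ⟨?_, ?_⟩
    · refine Eventually.of_forall fun t => ?_
      exact (hrot _ (hcn t)).integrable_comp_of_integrable hGi
    · have : ∀ t : ℝ, ∫ z, ‖G (circleMap 0 1 t • z)‖ ∂μ = ∫ z, ‖G z‖ ∂μ := by
        intro t
        have h1 := hrot _ (hcn t)
        have h2 := integral_map (μ := μ) h1.measurable.aemeasurable (f := fun z => ‖G z‖)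
          hGm.norm.aestronglyMeasurable
        rw [h1.map_eq] at h2
        exact h2.symm
      simp only [this]
      exact integrable_const _
  have hswap := integral_integral_swap hint
  have hL : ∀ t : ℝ, ∫ z, G (circleMap 0 1 t • z) ∂μ = ∫ z, G z ∂μ := by
    intro t
    have h1 := hrot _ (hcn t)
    have h2 := integral_map (μ := μ) h1.measurable.aemeasurable (f := G)
      hGm.aestronglyMeasurable
    rw [h1.map_eq] at h2
    exact h2.symm
  have hR : ∀ᵐ z ∂μ, ∫ t, G (circleMap 0 1 t • z) ∂τ = 2 * Real.pi * F 0 := by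
    filter_upwards [hU] with z hz
    rw [← circle_mean hF hz, intervalIntegral.integral_of_le Real.two_pi_pos.le]
    refine integral_congr_ae (Eventually.of_forall fun t => ?_)
    have : circleMap 0 1 t • z ∈ ball (0 : E) R := by
      rw [mem_ball_zero_iff, norm_smul, hcn, one_mul]; exact mem_ball_zero_iff.1 hz
    simp only [hG]
    rw [indicator_of_mem this]
  simp only [hL] at hswap
  rw [integral_congr_ae hR] at hswap
  rw [integral_const, integral_const] at hswap
  rw [← integral_congr_ae hGF]
  have hpi : τ.real univ = 2 * Real.pi := by
    simp [hτ, Real.two_pi_pos.le]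
  rw [hpi] at hswap
  simp only [Complex.real_smul] at hswap
  push_cast at hswap
  have hpi0 : (2 * Real.pi : ℂ) ≠ 0 := by
    exact_mod_cast Real.two_pi_pos.ne'
  have : (2 * Real.pi : ℂ) * (∫ z, G z ∂μ) = (2 * Real.pi : ℂ) * (μ.real univ * F 0) := by
    rw [hswap]; ring
  exact mul_left_cancel₀ hpi0 this

/-- A weighted change of variables combined with the mean value property. -/
theorem integral_mul_conj_of_map [SecondCountableTopology E] {μ : Measure E} [IsFiniteMeasure μ]
    (hrot : ∀ c : ℂ, ‖c‖ = 1 → MeasurePreserving (fun z : E => c • z) μ μ)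
    (hU : ∀ᵐ z ∂μ, z ∈ ball (0 : E) 1) {Φ : E → E} (hΦm : Measurable Φ) {J : E → ℝ}
    (hJm : Measurable J)
    (hmap : (μ.withDensity fun z => ENNReal.ofReal (J z)).map Φ = μ)
    (hΦ : DifferentiableOn ℂ Φ (ball 0 1)) (hΦU : MapsTo Φ (ball 0 1) (ball 0 1))
    {k f : E → ℂ} (hJ0 : ∀ z ∈ ball (0 : E) 1, 0 ≤ J z)
    (hk : ∀ z ∈ ball (0 : E) 1, J z * conj (k (Φ z)) = k z)
    (hkd : DifferentiableOn ℂ k (ball 0 1))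
    (hf : DifferentiableOn ℂ f (ball 0 1)) (hi : Integrable (fun z => f z * conj (k z)) μ) :
    ∫ z, f z * conj (k z) ∂μ = μ.real univ * (f (Φ 0) * k 0) := by
  have hJm' : Measurable fun z => ENNReal.ofReal (J z) := hJm.ennreal_ofReal
  have hi' : Integrable (fun z => f z * conj (k z))
      ((μ.withDensity fun z => ENNReal.ofReal (J z)).map Φ) := by rwa [hmap]
  have hae : (fun z => (ENNReal.ofReal (J z)).toReal • (f (Φ z) * conj (k (Φ z)))) =ᵐ[μ]
      fun z => f (Φ z) * k z := by
    filter_upwards [hU] with z hz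
    rw [ENNReal.toReal_ofReal (hJ0 z hz), Complex.real_smul, ← hk z hz]
    ring
  -- Substituting `Φ z` brings in the factor `J`, and `J * conj (k ∘ Φ)` is `k` itself: the
  -- conjugate disappears and the new integrand is holomorphic.
  have h1 : ∫ z, f z * conj (k z) ∂μ = ∫ z, f (Φ z) * k z ∂μ := by
    conv_lhs => rw [← hmap]
    rw [integral_map hΦm.aemeasurable hi'.aestronglyMeasurable,
      integral_withDensity_eq_integral_toReal_smul hJm' (by simp)]
    exact integral_congr_ae hae
  have h2 : Integrable (fun z => f (Φ z) * k z) μ := by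
    refine Integrable.congr ?_ hae
    rw [← integrable_withDensity_iff_integrable_smul' hJm' (by simp)]
    exact hi'.comp_measurable hΦm
  rw [h1]
  exact integral_eq_of_rotation hrot hU (F := fun z => f (Φ z) * k z)
    ((hf.comp hΦ hΦU).mul hkd) h2

end MeanValue

/-! ### Disk automorphisms and the hyperbolic measure -/

theorem disk_eq_ball : disk = ball (0 : ℂ) 1 := by
  ext z; simp [disk]

theorem bidisk_eq_ball : bidisk = ball (0 : ℂ × ℂ) 1 := by
  ext z; simp [bidisk, Prod.norm_def]

theorem bidisk_eq_prod : bidisk = disk ×ˢ disk := rfl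

theorem isOpen_disk : IsOpen disk := disk_eq_ball ▸ isOpen_ball

theorem isOpen_bidisk : IsOpen bidisk := bidisk_eq_ball ▸ isOpen_ball

/-- The function `1 - |z|²`. -/
def defect (z : ℂ) : ℝ := 1 - ‖z‖ ^ 2

theorem continuous_defect : Continuous defect := by unfold defect; fun_prop

theorem defect_pos {z : ℂ} (hz : z ∈ disk) : 0 < defect z := by
  have : ‖z‖ < 1 := hz
  unfold defect
  nlinarith [norm_nonneg z]

theorem ofReal_defect (z : ℂ) : (defect z : ℂ) = 1 - conj z * z := by
  rw [defect, Complex.conj_mul']; push_cast; ring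

theorem re_one_sub_pos {x y : ℂ} (hx : ‖x‖ < 1) (hy : ‖y‖ ≤ 1) : 0 < (1 - conj x * y).re := by
  have h1 : (conj x * y).re ≤ ‖conj x * y‖ := Complex.re_le_norm _
  rw [norm_mul, RCLike.norm_conj] at h1
  have : ‖x‖ * ‖y‖ < 1 := by nlinarith [norm_nonneg x, norm_nonneg y]
  simp only [Complex.sub_re, Complex.one_re]
  linarith

theorem one_sub_ne_zero {x y : ℂ} (hx : ‖x‖ < 1) (hy : ‖y‖ ≤ 1) : 1 - conj x * y ≠ 0 := by
  intro h
  have := re_one_sub_pos hx hy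
  rw [h] at this
  simp at this

theorem one_sub_norm_le {x y : ℂ} (hy : ‖y‖ ≤ 1) : 1 - ‖x‖ ≤ ‖1 - conj x * y‖ := by
  have h1 : ‖(1 : ℂ)‖ - ‖conj x * y‖ ≤ ‖1 - conj x * y‖ := norm_sub_norm_le _ _
  rw [norm_mul, RCLike.norm_conj, norm_one] at h1
  nlinarith [norm_nonneg x, norm_nonneg y]

theorem norm_one_sub_le_two {x y : ℂ} (hx : ‖x‖ ≤ 1) (hy : ‖y‖ ≤ 1) :
    ‖1 - conj x * y‖ ≤ 2 := by
  have h1 : ‖1 - conj x * y‖ ≤ ‖(1 : ℂ)‖ + ‖conj x * y‖ := norm_sub_le _ _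
  rw [norm_mul, RCLike.norm_conj, norm_one] at h1
  nlinarith [norm_nonneg x, norm_nonneg y]

/-- The involutive automorphism of the disk that exchanges `0` and `a`. -/
def mob (a z : ℂ) : ℂ := (a - z) / (1 - conj a * z)

@[simp] theorem mob_zero (a : ℂ) : mob a 0 = a := by simp [mob]

theorem measurable_mob (a : ℂ) : Measurable (mob a) := by unfold mob; fun_prop

theorem one_sub_conj_mul_mob {a z : ℂ} (ha : a ∈ disk) (hz : z ∈ disk) :
    1 - conj a * mob a z = defect a / (1 - conj a * z) := by
  have h := one_sub_ne_zero ha (le_of_lt hz)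
  rw [ofReal_defect, mob]
  field_simp
  ring

theorem mob_sub_mob {a u v : ℂ} (ha : a ∈ disk) (hu : u ∈ disk) (hv : v ∈ disk) :
    mob a u - mob a v = (v - u) * defect a / ((1 - conj a * u) * (1 - conj a * v)) := by
  have h1 := one_sub_ne_zero ha (le_of_lt hu)
  have h2 := one_sub_ne_zero ha (le_of_lt hv)
  rw [ofReal_defect, mob, mob, div_sub_div _ _ h1 h2]
  congr 1
  ring

theorem one_sub_conj_mob_mul_mob {a u v : ℂ} (ha : a ∈ disk) (hu : u ∈ disk) (hv : v ∈ disk) :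
    1 - conj (mob a v) * mob a u =
      (1 - conj v * u) * defect a / ((1 - conj a * u) * conj (1 - conj a * v)) := by
  have h1 := one_sub_ne_zero ha (le_of_lt hu)
  have h2 := one_sub_ne_zero ha (le_of_lt hv)
  have h3 : conj (1 - conj a * v) ≠ 0 := (map_ne_zero _).2 h2
  rw [ofReal_defect, mob, mob, map_div₀, div_mul_div_comm, mul_comm (conj (1 - conj a * v)),
    eq_div_iff (mul_ne_zero h1 h3), sub_mul, div_mul_cancel₀ _ (mul_ne_zero h1 h3)]
  simp only [map_sub, map_one, map_mul, Complex.conj_conj]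
  ring

theorem defect_mob {a z : ℂ} (ha : a ∈ disk) (hz : z ∈ disk) :
    defect (mob a z) = defect a * defect z / ‖1 - conj a * z‖ ^ 2 := by
  have h1 := one_sub_conj_mob_mul_mob ha hz hz
  rw [← ofReal_defect, ← ofReal_defect, Complex.mul_conj'] at h1
  have : ((defect (mob a z) : ℝ) : ℂ) = ((defect a * defect z / ‖1 - conj a * z‖ ^ 2 : ℝ) : ℂ) := by
    rw [h1]; push_cast; ring
  exact_mod_cast this

theorem mob_mem {a z : ℂ} (ha : a ∈ disk) (hz : z ∈ disk) : mob a z ∈ disk := by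
  have h := defect_mob ha hz
  have h1 : 0 < ‖1 - conj a * z‖ := norm_pos_iff.2 (one_sub_ne_zero ha (le_of_lt hz))
  have h2 : 0 < defect (mob a z) := by
    rw [h]
    have := defect_pos ha
    have := defect_pos hz
    positivity
  unfold defect at h2
  change ‖mob a z‖ < 1
  nlinarith [norm_nonneg (mob a z)]

theorem mob_mob {a z : ℂ} (ha : a ∈ disk) (hz : z ∈ disk) : mob a (mob a z) = z := by
  have h1 := one_sub_ne_zero ha (le_of_lt hz)
  have h2 : (defect a : ℂ) ≠ 0 := by exact_mod_cast (defect_pos ha).ne'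
  have h3 := one_sub_conj_mul_mob ha hz
  conv_lhs => rw [mob]
  rw [h3, div_eq_iff (div_ne_zero h2 h1), ofReal_defect, mob, ← mul_div_assoc,
    eq_div_iff h1, sub_mul, div_mul_cancel₀ _ h1]
  ring

theorem hasDerivAt_mob {a z : ℂ} (ha : a ∈ disk) (hz : z ∈ disk) :
    HasDerivAt (mob a) (-(defect a : ℂ) / (1 - conj a * z) ^ 2) z := by
  have h1 := one_sub_ne_zero ha (le_of_lt hz)
  have h2 : HasDerivAt (fun z => a - z) (-1) z := by
    simpa using (hasDerivAt_id z).const_sub a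
  have h3 : HasDerivAt (fun z => 1 - conj a * z) (-conj a) z := by
    simpa using ((hasDerivAt_id z).const_mul (conj a)).const_sub 1
  convert! h2.div h3 h1 using 1
  rw [ofReal_defect]
  ring

theorem differentiableOn_mob {a : ℂ} (ha : a ∈ disk) : DifferentiableOn ℂ (mob a) disk :=
  fun _ hz => (hasDerivAt_mob ha hz).differentiableAt.differentiableWithinAt

theorem mob_injOn {a : ℂ} (ha : a ∈ disk) : InjOn (mob a) disk := by
  intro x hx y hy h
  rw [← mob_mob ha hx, h, mob_mob ha hy]

theorem abs_det_restrictScalars (c : ℂ) :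
    |((ContinuousLinearMap.toSpanSingleton ℂ c).restrictScalars ℝ).det| = ‖c‖ ^ 2 := by
  have : ((ContinuousLinearMap.toSpanSingleton ℂ c).restrictScalars ℝ).det = Complex.normSq c := by
    simp [ContinuousLinearMap.det, LinearMap.det_restrictScalars, Algebra.norm_complex_apply]
  rw [this, Complex.normSq_eq_norm_sq, abs_of_nonneg (by positivity)]

/-- The Möbius invariant measure on the unit disk. -/
def hyp : Measure ℂ :=
  (volume.restrict disk).withDensity fun z => ENNReal.ofReal ((defect z ^ 2)⁻¹)

instance : SFinite hyp := by unfold hyp; infer_instance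

theorem hyp_ae_mem : ∀ᵐ z ∂hyp, z ∈ disk :=
  (withDensity_absolutelyContinuous _ _).ae_le (ae_restrict_mem isOpen_disk.measurableSet)

theorem measurable_hyp_density : Measurable fun z => ENNReal.ofReal ((defect z ^ 2)⁻¹) := by
  have := continuous_defect.measurable
  fun_prop

/-- The real Jacobian is `(defect a)² / |1 - conj a * z|⁴`, which by `defect_mob` is exactly the
factor by which the density changes. Being an involution of the disk, `mob a` has known images. -/
theorem measurePreserving_mob {a : ℂ} (ha : a ∈ disk) : MeasurePreserving (mob a) hyp hyp := by
  refine ⟨measurable_mob a, ?_⟩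
  have hd : MeasurableSet disk := isOpen_disk.measurableSet
  ext s hs
  have hms : MeasurableSet (mob a ⁻¹' s) := measurable_mob a hs
  rw [Measure.map_apply (measurable_mob a) hs]
  simp only [hyp]
  rw [withDensity_apply _ hms, withDensity_apply _ hs, Measure.restrict_restrict hms,
    Measure.restrict_restrict hs]
  have himg : mob a '' (mob a ⁻¹' s ∩ disk) = s ∩ disk := by
    ext z
    constructor
    · rintro ⟨w, ⟨hw1, hw2⟩, rfl⟩; exact ⟨hw1, mob_mem ha hw2⟩
    · rintro ⟨h1, h2⟩
      exact ⟨mob a z, ⟨by simpa [mob_mob ha h2] using h1, mob_mem ha h2⟩, mob_mob ha h2⟩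
  rw [← himg, lintegral_image_eq_lintegral_abs_det_fderiv_mul volume (hms.inter hd)
    (f' := fun z => (ContinuousLinearMap.toSpanSingleton ℂ
      (-(defect a : ℂ) / (1 - conj a * z) ^ 2)).restrictScalars ℝ)
    (fun z hz => ((hasDerivAt_mob ha hz.2).hasFDerivAt.restrictScalars ℝ).hasFDerivWithinAt)
    ((mob_injOn ha).mono inter_subset_right)]
  refine setLIntegral_congr_fun (hms.inter hd) fun z hz => ?_
  have h0 : 0 < ‖1 - conj a * z‖ := norm_pos_iff.2 (one_sub_ne_zero ha (le_of_lt hz.2))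
  have h1 := defect_pos ha
  have h2 := defect_pos hz.2
  rw [abs_det_restrictScalars, ← ENNReal.ofReal_mul (by positivity), defect_mob ha hz.2]
  congr 1
  rw [norm_div, norm_neg, norm_pow, Complex.norm_real, Real.norm_of_nonneg h1.le]
  field_simp

theorem measurePreserving_rotation {c : ℂ} (hc : ‖c‖ = 1) :
    MeasurePreserving (fun z : ℂ => c * z) volume volume := by
  let e := rotation ⟨c, by simpa [Submonoid.unitSphere] using hc⟩
  have h : Measure.map e volume = volume := e.measurePreserving.map_eq
  exact ⟨measurable_const_mul c, h⟩

theorem measurePreserving_rotation_hyp {c : ℂ} (hc : ‖c‖ = 1) :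
    MeasurePreserving (fun z : ℂ => c * z) hyp hyp := by
  have hpre : (fun z : ℂ => c * z) ⁻¹' disk = disk := by
    ext z; simp [disk, hc]
  have h1 := (measurePreserving_rotation hc).restrict_preimage isOpen_disk.measurableSet
  rw [hpre] at h1
  refine measurePreserving_withDensity h1 measurable_hyp_density (Eventually.of_forall fun z => ?_)
  simp [defect, hc]

/-- The density of `dA α` with respect to the hyperbolic measure. -/
def dens (α : ℝ) (z : ℂ) : ℝ := (α + 1) / Real.pi * defect z ^ (α + 2)

theorem measurable_dens (α : ℝ) : Measurable (dens α) := by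
  have := continuous_defect.measurable
  unfold dens
  fun_prop

theorem dens_pos {α : ℝ} (hα : -1 < α) {z : ℂ} (hz : z ∈ disk) : 0 < dens α z := by
  have := defect_pos hz
  have : 0 < α + 1 := by linarith
  have := Real.pi_pos
  unfold dens
  positivity

theorem dA_eq (α : ℝ) : dA α = hyp.withDensity fun z => ENNReal.ofReal (dens α z) := by
  rw [hyp, ← withDensity_mul _ measurable_hyp_density (measurable_dens α).ennreal_ofReal, dA]
  refine withDensity_congr_ae ?_
  filter_upwards [ae_restrict_mem isOpen_disk.measurableSet] with z hz
  have h := defect_pos hz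
  rw [Pi.mul_apply, ← ENNReal.ofReal_mul (by positivity)]
  congr 1
  rw [dens, Real.rpow_add h, Real.rpow_two]
  change (α + 1) * (defect z) ^ α / Real.pi = _
  field_simp

/-- The density of `bidiskMeasure` with respect to the product of the hyperbolic measures. -/
def bidens (α β θ ϑ : ℝ) (z : ℂ × ℂ) : ℝ := dens α z.1 * dens β z.2 * weight θ ϑ z

theorem measurable_weight (θ ϑ : ℝ) : Measurable (weight θ ϑ) := by
  have : Measurable (conj : ℂ → ℂ) := Complex.continuous_conj.measurable
  unfold weight
  fun_prop

theorem weight_nonneg (θ ϑ : ℝ) (z : ℂ × ℂ) : 0 ≤ weight θ ϑ z := by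
  unfold weight; positivity

theorem measurable_bidens (α β θ ϑ : ℝ) : Measurable (bidens α β θ ϑ) := by
  have := measurable_dens α
  have := measurable_dens β
  have := measurable_weight θ ϑ
  unfold bidens
  fun_prop

theorem hyp_prod_ae_mem : ∀ᵐ z ∂hyp.prod hyp, z ∈ bidisk := by
  have h1 := Measure.quasiMeasurePreserving_fst (μ := hyp) (ν := hyp) |>.ae hyp_ae_mem
  have h2 := Measure.quasiMeasurePreserving_snd (μ := hyp) (ν := hyp) |>.ae hyp_ae_mem
  filter_upwards [h1, h2] with z h1 h2 using ⟨h1, h2⟩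

theorem dA_prod_eq (α β : ℝ) : (dA α).prod (dA β) = (hyp.prod hyp).withDensity fun z =>
    ENNReal.ofReal (dens α z.1) * ENNReal.ofReal (dens β z.2) := by
  rw [dA_eq, dA_eq, prod_withDensity (measurable_dens α).ennreal_ofReal
    (measurable_dens β).ennreal_ofReal]

theorem bidiskMeasure_eq {α β : ℝ} (θ ϑ : ℝ) (hα : -1 < α) (hβ : -1 < β) :
    bidiskMeasure α β θ ϑ =
      (hyp.prod hyp).withDensity fun z => ENNReal.ofReal (bidens α β θ ϑ z) := by
  have h1 := (measurable_dens α).ennreal_ofReal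
  have h2 := (measurable_dens β).ennreal_ofReal
  have h3 := (measurable_weight θ ϑ).ennreal_ofReal
  have h4 : Measurable fun z : ℂ × ℂ =>
      ENNReal.ofReal (dens α z.1) * ENNReal.ofReal (dens β z.2) :=
    (h1.comp measurable_fst).mul (h2.comp measurable_snd)
  rw [bidiskMeasure, dA_prod_eq, ← withDensity_mul _ h4 h3]
  refine withDensity_congr_ae ?_
  filter_upwards [hyp_prod_ae_mem] with z hz
  have hp1 := dens_pos hα hz.1
  have hp2 := dens_pos hβ hz.2
  rw [Pi.mul_apply, ← ENNReal.ofReal_mul hp1.le, ← ENNReal.ofReal_mul (by positivity), bidens]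

theorem dA_ae_mem (α : ℝ) : ∀ᵐ z ∂dA α, z ∈ disk :=
  (withDensity_absolutelyContinuous _ _).ae_le (ae_restrict_mem isOpen_disk.measurableSet)

instance (α : ℝ) : SFinite (dA α) := by unfold dA; infer_instance

theorem dA_prod_ae_mem (α β : ℝ) : ∀ᵐ z ∂(dA α).prod (dA β), z ∈ bidisk := by
  rw [dA_prod_eq]
  exact (withDensity_absolutelyContinuous _ _).ae_le hyp_prod_ae_mem

theorem bidiskMeasure_ae_mem (α β θ ϑ : ℝ) : ∀ᵐ z ∂bidiskMeasure α β θ ϑ, z ∈ bidisk :=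
  (withDensity_absolutelyContinuous _ _).ae_le (dA_prod_ae_mem α β)

theorem measurePreserving_rotation_dA (α : ℝ) {c : ℂ} (hc : ‖c‖ = 1) :
    MeasurePreserving (fun z : ℂ => c • z) (dA α) (dA α) := by
  rw [dA_eq]
  refine measurePreserving_withDensity (measurePreserving_rotation_hyp hc)
    (measurable_dens α).ennreal_ofReal (Eventually.of_forall fun z => ?_)
  simp [dens, defect, hc]

theorem measurePreserving_rotation_bidisk {α β : ℝ} (θ ϑ : ℝ) (hα : -1 < α) (hβ : -1 < β)
    {c : ℂ} (hc : ‖c‖ = 1) :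
    MeasurePreserving (fun z : ℂ × ℂ => c • z) (bidiskMeasure α β θ ϑ)
      (bidiskMeasure α β θ ϑ) := by
  rw [bidiskMeasure_eq θ ϑ hα hβ]
  refine measurePreserving_withDensity
    ((measurePreserving_rotation_hyp hc).prod (measurePreserving_rotation_hyp hc))
    (measurable_bidens α β θ ϑ).ennreal_ofReal (Eventually.of_forall fun z => ?_)
  have h1 : conj (c * z.2) * (c * z.1) = conj z.2 * z.1 := by
    have : conj c * c = 1 := by rw [Complex.conj_mul', hc]; simp
    rw [map_mul]
    linear_combination conj z.2 * z.1 * this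
  simp only [bidens, dens, defect, weight, Prod.map_fst, Prod.map_snd, norm_mul, hc, one_mul, h1,
    ← mul_sub]

/-- Each of the four factors of the density is covariant under the diagonal action. The resulting
multiplier is a constant times the squared modulus of a holomorphic function of `(u, v)`, which is
what makes kernels at diagonal points explicit. -/
theorem bidens_mob {α β θ ϑ : ℝ} {a u v : ℂ} (ha : a ∈ disk) (hu : u ∈ disk) (hv : v ∈ disk) :
    bidens α β θ ϑ (mob a u, mob a v) =
      defect a ^ (α + β + 2 * θ + 2 * ϑ + 4) * ‖1 - conj a * u‖ ^ (-(2 * (α + θ + ϑ + 2))) *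
        ‖1 - conj a * v‖ ^ (-(2 * (β + θ + ϑ + 2))) * bidens α β θ ϑ (u, v) := by
  have h1 : 0 < ‖1 - conj a * u‖ := norm_pos_iff.2 (one_sub_ne_zero ha (le_of_lt hu))
  have h2 : 0 < ‖1 - conj a * v‖ := norm_pos_iff.2 (one_sub_ne_zero ha (le_of_lt hv))
  have hda := defect_pos ha
  have hdu := defect_pos hu
  have hdv := defect_pos hv
  simp only [bidens, dens, weight, one_sub_conj_mob_mul_mob ha hu hv, mob_sub_mob ha hu hv,
    defect_mob ha hu, defect_mob ha hv]
  simp only [norm_div, norm_mul, Complex.norm_real, Real.norm_of_nonneg hda.le, RCLike.norm_conj,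
    norm_sub_rev v u]
  set A := ‖1 - conj a * u‖
  set B := ‖1 - conj a * v‖
  set D := defect a
  rw [Real.div_rpow (by positivity) (by positivity), Real.div_rpow (by positivity) (by positivity),
    Real.div_rpow (by positivity) (by positivity), Real.div_rpow (by positivity) (by positivity),
    Real.mul_rpow (by positivity) (by positivity), Real.mul_rpow (by positivity) (by positivity),
    Real.mul_rpow (by positivity) (by positivity), Real.mul_rpow (by positivity) (by positivity),
    Real.mul_rpow (by positivity) (by positivity), Real.mul_rpow (by positivity) (by positivity),
    ← Real.rpow_two, ← Real.rpow_two, ← Real.rpow_mul h1.le, ← Real.rpow_mul h2.le]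
  have eD : D ^ (α + β + 2 * θ + 2 * ϑ + 4) =
      D ^ (α + 2) * D ^ (β + 2) * D ^ (2 * ϑ) * D ^ (2 * θ) := by
    rw [← Real.rpow_add hda, ← Real.rpow_add hda, ← Real.rpow_add hda]; congr 1; ring
  have eA : A ^ (-(2 * (α + θ + ϑ + 2))) =
      (A ^ (2 * (α + 2)) * A ^ (2 * ϑ) * A ^ (2 * θ))⁻¹ := by
    rw [← Real.rpow_add h1, ← Real.rpow_add h1, ← Real.rpow_neg h1.le]; congr 1; ring
  have eB : B ^ (-(2 * (β + θ + ϑ + 2))) =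
      (B ^ (2 * (β + 2)) * B ^ (2 * ϑ) * B ^ (2 * θ))⁻¹ := by
    rw [← Real.rpow_add h2, ← Real.rpow_add h2, ← Real.rpow_neg h2.le]; congr 1; ring
  rw [eD, eA, eB]
  field_simp

/-! ### Powers of `1 - conj ξ * z` -/

/-- The function `(1 - conj ξ * z) ^ (-c)`, with the principal power. -/
def szego (c : ℝ) (ξ z : ℂ) : ℂ := (1 - conj ξ * z) ^ ((-c : ℝ) : ℂ)

theorem norm_szego (c : ℝ) (ξ z : ℂ) : ‖szego c ξ z‖ = ‖1 - conj ξ * z‖ ^ (-c) :=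
  Complex.norm_cpow_real _ _

@[simp] theorem szego_zero (c : ℝ) (ξ : ℂ) : szego c ξ 0 = 1 := by simp [szego]

theorem szego_ne_zero {c : ℝ} {ξ z : ℂ} (hξ : ξ ∈ disk) (hz : z ∈ disk) : szego c ξ z ≠ 0 := by
  rw [← norm_ne_zero_iff, norm_szego]
  have := norm_pos_iff.2 (one_sub_ne_zero hξ (le_of_lt hz))
  positivity

theorem one_sub_mem_slitPlane {x y : ℂ} (hx : ‖x‖ < 1) (hy : ‖y‖ ≤ 1) :
    1 - conj x * y ∈ Complex.slitPlane :=
  Or.inl (re_one_sub_pos hx hy)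

theorem differentiableOn_szego (c : ℝ) {ξ : ℂ} (hξ : ξ ∈ disk) :
    DifferentiableOn ℂ (szego c ξ) disk := by
  intro z hz
  refine DifferentiableAt.differentiableWithinAt ?_
  refine DifferentiableAt.cpow (by fun_prop) (by fun_prop) (one_sub_mem_slitPlane hξ (le_of_lt hz))

theorem szego_conj_symm {c : ℝ} {ξ z : ℂ} (hξ : ξ ∈ disk) (hz : z ∈ disk) :
    conj (szego c ξ z) = szego c z ξ := by
  have h := Complex.mem_slitPlane_iff_arg.1 (one_sub_mem_slitPlane hξ (le_of_lt hz))
  rw [szego, szego]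
  have h2 := Complex.conj_cpow (1 - conj ξ * z) ((-c : ℝ) : ℂ) h.1
  rw [Complex.conj_ofReal] at h2
  rw [← h2]
  congr 1
  simp [mul_comm]

theorem szego_add {c d : ℝ} {ξ z : ℂ} (hξ : ξ ∈ disk) (hz : z ∈ disk) :
    szego (c + d) ξ z = szego c ξ z * szego d ξ z := by
  rw [szego, szego, szego, ← Complex.cpow_add _ _ (one_sub_ne_zero hξ (le_of_lt hz))]
  congr 1
  push_cast; ring

theorem abs_arg_lt_of_re_pos {x : ℂ} (hx : 0 < x.re) : |x.arg| < Real.pi / 2 :=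
  Complex.abs_arg_lt_pi_div_two_iff.2 (Or.inl hx)

/-- Both arguments lie in `(-π/2, π/2)`, so their sum stays within the range of the principal
logarithm. -/
theorem mul_cpow_of_re_pos {x y : ℂ} (hx : 0 < x.re) (hy : 0 < y.re) (c : ℂ) :
    (x * y) ^ c = x ^ c * y ^ c := by
  have hx0 : x ≠ 0 := by rintro rfl; simp at hx
  have hy0 : y ≠ 0 := by rintro rfl; simp at hy
  have h1 := abs_lt.1 (abs_arg_lt_of_re_pos hx)
  have h2 := abs_lt.1 (abs_arg_lt_of_re_pos hy)
  rw [Complex.cpow_def_of_ne_zero (mul_ne_zero hx0 hy0), Complex.cpow_def_of_ne_zero hx0,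
    Complex.cpow_def_of_ne_zero hy0, ← Complex.exp_add,
    Complex.log_mul_eq_add_log_iff hx0 hy0 |>.2 ⟨by linarith, by linarith⟩, add_mul]

theorem szego_mob {c : ℝ} {ξ z : ℂ} (hξ : ξ ∈ disk) (hz : z ∈ disk) :
    szego c ξ (mob ξ z) * szego c ξ z = ((defect ξ ^ (-c) : ℝ) : ℂ) := by
  have h1 := re_one_sub_pos hξ (le_of_lt (mob_mem hξ hz))
  have h2 := re_one_sub_pos hξ (le_of_lt hz)
  rw [szego, szego, ← mul_cpow_of_re_pos h1 h2, one_sub_conj_mul_mob hξ hz,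
    div_mul_cancel₀ _ (one_sub_ne_zero hξ (le_of_lt hz)),
    ← Complex.ofReal_cpow (defect_pos hξ).le]

/-- The base lies between `1 - ‖x‖` and `2`; since `c` may have either sign, the values at both ends
are added. -/
theorem norm_szego_le {c : ℝ} {x y : ℂ} (hx : ‖x‖ < 1) (hy : ‖y‖ ≤ 1) :
    ‖szego c x y‖ ≤ (1 - ‖x‖) ^ (-c) + 2 ^ (-c) := by
  rw [norm_szego]
  have h0 : 0 < 1 - ‖x‖ := by linarith
  have h1 := one_sub_norm_le (x := x) hy
  have h2 := norm_one_sub_le_two hx.le hy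
  have h3 : 0 ≤ (1 - ‖x‖) ^ (-c) := by positivity
  have h4 : (0 : ℝ) ≤ 2 ^ (-c) := by positivity
  rcases le_or_gt 0 c with hc | hc
  · have := Real.rpow_le_rpow_of_nonpos h0 h1 (by linarith : -c ≤ 0)
    linarith
  · have := Real.rpow_le_rpow (by positivity) h2 (by linarith : 0 ≤ -c)
    linarith

/-! ### Radial integrals -/

/-- In `1 - r² = (1 + r)(1 - r)` the first factor stays between `1` and `2`, so the Beta integral
dominates. -/
theorem integrableOn_beta {x y : ℝ} (hx : -1 < x) (hy : -1 < y) :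
    IntegrableOn (fun r : ℝ => r ^ x * (1 - r ^ 2) ^ y) (Ioo 0 1) := by
  have h1 := Complex.betaIntegral_convergent (u := ((x + 1 : ℝ) : ℂ)) (v := ((y + 1 : ℝ) : ℂ))
    (by simp; linarith) (by simp; linarith)
  rw [intervalIntegrable_iff_integrableOn_Ioo_of_le zero_le_one] at h1
  have h2 : IntegrableOn (fun r : ℝ => r ^ x * (1 - r) ^ y) (Ioo 0 1) := by
    refine IntegrableOn.congr_fun (f := _) h1.norm (fun r hr => ?_) measurableSet_Ioo
    have hr1 : 0 < 1 - r := by linarith [hr.2]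
    simp only [norm_mul]
    have e1 : ((x + 1 : ℝ) : ℂ) - 1 = (x : ℂ) := by push_cast; ring
    have e2 : ((y + 1 : ℝ) : ℂ) - 1 = (y : ℂ) := by push_cast; ring
    have e3 : (1 : ℂ) - (r : ℂ) = ((1 - r : ℝ) : ℂ) := by push_cast; ring
    rw [e1, e2, e3, Complex.norm_cpow_real, Complex.norm_cpow_real, Complex.norm_real,
      Complex.norm_real, Real.norm_of_nonneg hr.1.le, Real.norm_of_nonneg hr1.le]
  have h3 : IntegrableOn (fun r : ℝ => (2 ^ y + 1) * (r ^ x * (1 - r) ^ y)) (Ioo 0 1) :=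
    h2.const_mul _
  refine Integrable.mono' h3 (by fun_prop) ?_
  filter_upwards [ae_restrict_mem measurableSet_Ioo] with r hr
  have hr1 : 0 < 1 - r := by linarith [hr.2]
  have hr0 := hr.1
  have e : 1 - r ^ 2 = (1 + r) * (1 - r) := by ring
  rw [e, Real.mul_rpow (by linarith) hr1.le, Real.norm_of_nonneg (by positivity)]
  have hle : (1 + r) ^ y ≤ 2 ^ y + 1 := by
    rcases le_or_gt 0 y with h | h
    · have := Real.rpow_le_rpow (by linarith) (by linarith [hr.2] : 1 + r ≤ 2) h
      linarith
    · have := Real.rpow_le_one_of_one_le_of_nonpos (by linarith : 1 ≤ 1 + r) h.le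
      have : (0 : ℝ) ≤ 2 ^ y := by positivity
      linarith
  calc r ^ x * ((1 + r) ^ y * (1 - r) ^ y) = (1 + r) ^ y * (r ^ x * (1 - r) ^ y) := by ring
    _ ≤ _ := by gcongr

theorem integrableOn_norm_rpow_mul_defect {x y : ℝ} (hx : -2 < x) (hy : -1 < y) :
    IntegrableOn (fun z : ℂ => ‖z‖ ^ x * defect z ^ y) disk := by
  have h := integrableOn_beta (x := x + 1) (y := y) (by linarith) hy
  rw [disk_eq_ball]
  refine (integrableOn_fun_norm_addHaar (volume : Measure ℂ)
    (f := fun r : ℝ => r ^ x * (1 - r ^ 2) ^ y)).2 ?_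
  refine h.congr_fun (fun r hr => ?_) measurableSet_Ioo
  simp only [Complex.finrank_real_complex, Nat.add_one_sub_one, pow_one, smul_eq_mul]
  rw [Real.rpow_add_one hr.1.ne']
  ring

theorem integral_mul_one_sub_sq {s : ℝ} (hs : -1 < s) :
    ∫ r in (0 : ℝ)..1, r * (1 - r ^ 2) ^ s = 1 / (2 * (s + 1)) := by
  have hs1 : 0 < s + 1 := by linarith
  have hint : IntervalIntegrable (fun r : ℝ => r * (1 - r ^ 2) ^ s) volume 0 1 := by
    rw [intervalIntegrable_iff_integrableOn_Ioo_of_le zero_le_one]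
    simpa using integrableOn_beta (x := 1) (by norm_num) hs
  have := intervalIntegral.integral_eq_sub_of_hasDerivAt_of_le (a := 0) (b := 1)
    (f := fun r : ℝ => -(1 - r ^ 2) ^ (s + 1) / (2 * (s + 1)))
    (f' := fun r : ℝ => r * (1 - r ^ 2) ^ s) zero_le_one ?_ ?_ hint
  · rw [this]
    simp [Real.zero_rpow hs1.ne', neg_div]
  · refine ContinuousOn.div_const (ContinuousOn.neg ?_) _
    exact ContinuousOn.rpow_const (by fun_prop) fun _ _ => Or.inr hs1.le
  · intro r hr
    have h0 : 0 < 1 - r ^ 2 := by nlinarith [hr.1, hr.2]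
    have h1 : HasDerivAt (fun r : ℝ => 1 - r ^ 2) (-(2 * r)) r := by
      simpa using (hasDerivAt_pow 2 r).const_sub 1
    have h2 := (((h1.rpow_const (p := s + 1) (Or.inl h0.ne')).neg).div_const (2 * (s + 1)))
    refine h2.congr_deriv ?_
    rw [add_sub_cancel_right]
    field_simp

theorem integral_defect_rpow {s : ℝ} (hs : -1 < s) :
    ∫ z in disk, defect z ^ s = Real.pi / (s + 1) := by
  rw [← integral_indicator isOpen_disk.measurableSet]
  have h1 : (disk.indicator fun z : ℂ => defect z ^ s) =
      fun z : ℂ => (Iio (1 : ℝ)).indicator (fun r : ℝ => (1 - r ^ 2) ^ s) ‖z‖ := by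
    ext z
    simp only [indicator, disk, mem_ofPred_eq, mem_Iio]
    rfl
  rw [h1, integral_fun_norm_addHaar]
  have h2 : ∫ y in Ioi (0 : ℝ), y ^ (Module.finrank ℝ ℂ - 1) •
      (Iio (1 : ℝ)).indicator (fun r : ℝ => (1 - r ^ 2) ^ s) y = 1 / (2 * (s + 1)) := by
    rw [← integral_mul_one_sub_sq hs, intervalIntegral.integral_of_le zero_le_one,
      integral_Ioc_eq_integral_Ioo]
    have : ∀ y : ℝ, y ^ (Module.finrank ℝ ℂ - 1) •
      (Iio (1 : ℝ)).indicator (fun r : ℝ => (1 - r ^ 2) ^ s) y =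
      (Iio (1 : ℝ)).indicator (fun r : ℝ => r * (1 - r ^ 2) ^ s) y := by
      intro y
      simp only [Complex.finrank_real_complex, Nat.add_one_sub_one, pow_one, smul_eq_mul,
        indicator]
      split_ifs <;> simp
    simp only [this]
    rw [setIntegral_indicator measurableSet_Iio, Ioi_inter_Iio]
  rw [h2]
  have h3 : (volume : Measure ℂ).real (ball 0 1) = Real.pi := by
    simp [Measure.real, Complex.volume_ball]
  have : s + 1 ≠ 0 := by linarith
  rw [h3]
  simp only [Complex.finrank_real_complex, nsmul_eq_mul, smul_eq_mul]
  push_cast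
  field_simp

theorem dA_univ {s : ℝ} (hs : -1 < s) : dA s univ = 1 := by
  have hs1 : 0 < s + 1 := by linarith
  have hpi := Real.pi_pos
  rw [dA, withDensity_apply _ MeasurableSet.univ, Measure.restrict_univ]
  have h0 : ∀ᵐ z ∂(volume.restrict disk : Measure ℂ),
      0 ≤ (s + 1) * (1 - ‖z‖ ^ 2) ^ s / Real.pi := by
    filter_upwards [ae_restrict_mem isOpen_disk.measurableSet] with z hz
    have := defect_pos hz
    unfold defect at this
    positivity
  have hi := integrableOn_norm_rpow_mul_defect (x := 0) (by norm_num) hs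
  simp only [Real.rpow_zero, one_mul] at hi
  have h2 := ((hi.const_mul (s + 1)).div_const Real.pi)
  unfold defect at h2
  rw [← ofReal_integral_eq_lintegral_ofReal h2 h0, integral_div, integral_const_mul]
  change ENNReal.ofReal ((s + 1) * (∫ z in disk, defect z ^ s) / Real.pi) = 1
  rw [integral_defect_rpow hs]
  have : (s + 1) * (Real.pi / (s + 1)) / Real.pi = 1 := by field_simp
  rw [this, ENNReal.ofReal_one]

theorem isProbabilityMeasure_dA {s : ℝ} (hs : -1 < s) : IsProbabilityMeasure (dA s) :=
  ⟨dA_univ hs⟩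

theorem lintegral_norm_rpow_dA {x α : ℝ} (hx : -2 < x) (hα : -1 < α) :
    ∫⁻ u, ENNReal.ofReal (‖u‖ ^ x) ∂dA α < ∞ := by
  have hm : Measurable fun z : ℂ => ENNReal.ofReal ((α + 1) * (1 - ‖z‖ ^ 2) ^ α / Real.pi) := by
    fun_prop
  have hpi := Real.pi_pos
  rw [dA, lintegral_withDensity_eq_lintegral_mul _ hm (by fun_prop)]
  have hi := ((integrableOn_norm_rpow_mul_defect hx hα).const_mul ((α + 1) / Real.pi)).lintegral_lt_top
  refine lt_of_le_of_lt (lintegral_mono_ae ?_) hi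
  filter_upwards [ae_restrict_mem isOpen_disk.measurableSet] with z hz
  have hd := defect_pos hz
  have hα' : 0 < α + 1 := by linarith
  change ENNReal.ofReal ((α + 1) * defect z ^ α / Real.pi) * _ ≤ _
  rw [← ENNReal.ofReal_mul (by positivity)]
  refine (congrArg ENNReal.ofReal ?_).le
  ring

/-- For `w` in the right half plane, `Re w^(-p) ≥ |w|^(-p) cos (pπ/2)`. The real part of the
holomorphic function `szego p u` has mean `1`, so the bound is uniform in `u`; this is where `p < 1`
matters. -/
theorem lintegral_norm_one_sub_rpow {s p : ℝ} (hs : -1 < s) (hp0 : 0 ≤ p) (hp1 : p < 1) {u : ℂ}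
    (hu : u ∈ disk) :
    ∫⁻ v, ENNReal.ofReal (‖1 - conj v * u‖ ^ (-p)) ∂dA s ≤
      ENNReal.ofReal (Real.cos (p * (Real.pi / 2)))⁻¹ := by
  have := isProbabilityMeasure_dA hs
  have hpi := Real.pi_pos
  have hcos : 0 < Real.cos (p * (Real.pi / 2)) :=
    Real.cos_pos_of_mem_Ioo ⟨by nlinarith, by nlinarith⟩
  have hdiff := differentiableOn_szego p hu
  have hmeas : AEStronglyMeasurable (szego p u) (dA s) := by
    refine Measurable.aestronglyMeasurable ?_
    unfold szego
    fun_prop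
  have hint : Integrable (szego p u) (dA s) := by
    refine Integrable.of_bound hmeas ((1 - ‖u‖) ^ (-p) + 2 ^ (-p)) ?_
    filter_upwards [dA_ae_mem s] with v hv using norm_szego_le hu (le_of_lt hv)
  have hmv := integral_eq_of_rotation (R := 1) (fun c hc => measurePreserving_rotation_dA s hc)
    (by simpa only [disk_eq_ball] using dA_ae_mem s) (by simpa only [disk_eq_ball] using hdiff) hint
  have hone : ∫ v, (szego p u v).re ∂dA s = 1 := by
    have := integral_re hint
    simp only [RCLike.re_to_complex] at this
    rw [this, hmv]
    simp
  have hre : Integrable (fun v => (szego p u v).re) (dA s) := hint.re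
  have hpt : ∀ᵐ v ∂dA s, ‖1 - conj v * u‖ ^ (-p) ≤
      (Real.cos (p * (Real.pi / 2)))⁻¹ * (szego p u v).re := by
    filter_upwards [dA_ae_mem s] with v hv
    have hre := re_one_sub_pos hu (le_of_lt hv)
    have hne := one_sub_ne_zero hu (le_of_lt hv)
    have harg := abs_arg_lt_of_re_pos hre
    have hn : ‖1 - conj v * u‖ = ‖1 - conj u * v‖ := by
      rw [← RCLike.norm_conj (1 - conj v * u)]
      congr 1
      simp [mul_comm]
    rw [hn]
    set w := 1 - conj u * v
    have hsz : (szego p u v).re = ‖w‖ ^ (-p) * Real.cos (p * |w.arg|) := by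
      rw [szego]
      change (w ^ ((-p : ℝ) : ℂ)).re = _
      rw [Complex.cpow_def_of_ne_zero hne, Complex.exp_re, Real.rpow_def_of_pos
        (norm_pos_iff.2 hne)]
      simp only [Complex.re_mul_ofReal, Complex.im_mul_ofReal, Complex.log_re, Complex.log_im]
      congr 1
      rw [← Real.cos_abs, abs_mul, abs_neg, abs_of_nonneg hp0, mul_comm]
    rw [hsz, inv_mul_eq_div, le_div_iff₀ hcos]
    refine mul_le_mul_of_nonneg_left ?_ (by positivity)
    refine Real.cos_le_cos_of_nonneg_of_le_pi (by positivity) (by nlinarith) ?_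
    gcongr
  calc _ ≤ ∫⁻ v, ENNReal.ofReal ((Real.cos (p * (Real.pi / 2)))⁻¹ * (szego p u v).re) ∂dA s := by
        refine lintegral_mono_ae ?_
        filter_upwards [hpt] with v hv using ENNReal.ofReal_le_ofReal hv
    _ = ENNReal.ofReal (∫ v, (Real.cos (p * (Real.pi / 2)))⁻¹ * (szego p u v).re ∂dA s) := by
        rw [ofReal_integral_eq_lintegral_ofReal (hre.const_mul _)]
        filter_upwards [hpt] with v hv
        exact le_trans (by positivity) hv
    _ = _ := by rw [integral_const_mul, hone, mul_one]

/-! ### Finiteness of the weighted measure -/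

/-- The standing assumptions on the parameters. -/
structure Admissible (α β θ ϑ : ℝ) : Prop where
  alpha : -1 < α
  beta : -1 < β
  theta : -1 < θ
  vartheta : -1 < ϑ
  sum : 0 < α + β + 2 * θ + 2 * ϑ + 3

theorem Admissible.add_nat {α β θ ϑ : ℝ} (h : Admissible α β θ ϑ) (N : ℕ) :
    Admissible α β (θ + N) ϑ := by
  have hN : (0 : ℝ) ≤ N := N.cast_nonneg
  exact ⟨h.alpha, h.beta, by linarith [h.theta], h.vartheta, by linarith [h.sum]⟩

theorem norm_one_sub_conj_comm (u v : ℂ) : ‖1 - conj v * u‖ = ‖1 - conj u * v‖ := by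
  rw [← RCLike.norm_conj (1 - conj v * u)]
  congr 1
  simp [mul_comm]

theorem half_defect_le {u v : ℂ} (hu : u ∈ disk) (hv : v ∈ disk) :
    defect v / 2 ≤ ‖1 - conj v * u‖ := by
  have h1 := one_sub_norm_le (x := v) (le_of_lt hu)
  have hv' : ‖v‖ < 1 := hv
  unfold defect
  nlinarith [norm_nonneg v]

/-- Since `|1 - conj v * u|` dominates half of each defect, part of a negative power can be traded
for powers of the defects. The limits on `x` and `y` are those that keep the remaining weights in
`v` and `u` integrable, and what is left has exponent `p < 1`, as `lintegral_norm_one_sub_rpow`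
requires. -/
theorem exists_power_split {α β θ ϑ : ℝ} (h : Admissible α β θ ϑ) :
    ∃ C x y p : ℝ, 0 ≤ C ∧ x < α + β + 2 * θ + 2 * ϑ + 3 ∧ y < α + 1 ∧ 0 ≤ p ∧ p < 1 ∧
      ∀ u ∈ disk, ∀ v ∈ disk, ‖1 - conj v * u‖ ^ (-(2 * (α + θ + ϑ + 2))) ≤
        C * (‖1 - conj v * u‖ ^ (-p) * defect v ^ (-x) * defect u ^ (-y)) := by
  obtain ⟨hα, hβ, hθ, hϑ, hs⟩ := h
  rcases le_or_gt (α + θ + ϑ + 2) 0 with ha | ha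
  · refine ⟨2 ^ (-(2 * (α + θ + ϑ + 2))), 0, 0, 0, by positivity, hs, by linarith, le_rfl,
      one_pos, fun u hu v hv => ?_⟩
    simp only [neg_zero, Real.rpow_zero, mul_one]
    exact Real.rpow_le_rpow (norm_nonneg _)
      (norm_one_sub_le_two (le_of_lt hv) (le_of_lt hu)) (by linarith)
  · set S := α + β + 2 * θ + 2 * ϑ + 3 with hS
    -- The exponent is shared in the proportions `1 : S : α + 1`. The denominator exceeds the
    -- numerator by `β + 1`, whence `p < 1`.
    set p := 2 * (α + θ + ϑ + 2) / (S + (α + 1) + 1) with hp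
    have hden : 0 < S + (α + 1) + 1 := by linarith
    have hp0 : 0 < p := by positivity
    have hp1 : p < 1 := by rw [hp, div_lt_one hden]; linarith
    have hx : 0 ≤ p * S := by positivity
    have hα1 : 0 < α + 1 := by linarith
    have hy : 0 ≤ p * (α + 1) := by positivity
    refine ⟨2 ^ (p * S) * 2 ^ (p * (α + 1)), p * S, p * (α + 1), p, by positivity, by nlinarith,
      by nlinarith, hp0.le, hp1, fun u hu v hv => ?_⟩
    have h1 : 0 < ‖1 - conj v * u‖ := norm_pos_iff.2 (one_sub_ne_zero hv (le_of_lt hu))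
    have h2 := half_defect_le hu hv
    have h3 := half_defect_le hv hu
    rw [norm_one_sub_conj_comm] at h3
    have hdu := defect_pos hu
    have hdv := defect_pos hv
    have hsum : -(2 * (α + θ + ϑ + 2)) = -p + -(p * S) + -(p * (α + 1)) := by
      rw [hp]; field_simp; ring
    rw [hsum, Real.rpow_add h1, Real.rpow_add h1]
    have e1 := Real.rpow_le_rpow_of_nonpos (by positivity) h2 (neg_nonpos.2 hx)
    have e2 := Real.rpow_le_rpow_of_nonpos (by positivity) h3 (neg_nonpos.2 hy)
    rw [Real.div_rpow hdv.le zero_le_two, Real.rpow_neg zero_le_two, div_inv_eq_mul] at e1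
    rw [Real.div_rpow hdu.le zero_le_two, Real.rpow_neg zero_le_two, div_inv_eq_mul] at e2
    calc _ ≤ ‖1 - conj v * u‖ ^ (-p) * (defect v ^ (-(p * S)) * 2 ^ (p * S)) *
          (defect u ^ (-(p * (α + 1))) * 2 ^ (p * (α + 1))) := by gcongr
      _ = _ := by ring

theorem dens_mul_rpow {α x : ℝ} {z : ℂ} (hz : z ∈ disk) (hα : α + 1 ≠ 0) (hx : α - x + 1 ≠ 0) :
    dens α z * defect z ^ (-x) = (α + 1) / (α - x + 1) * dens (α - x) z := by
  rw [dens, dens, mul_assoc, ← Real.rpow_add (defect_pos hz)]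
  have : α + 2 + -x = α - x + 2 := by ring
  rw [this]
  field_simp

/-- As `v = mob v 0`, the point is the image of `(u, 0)` under the diagonal action, and `bidens_mob`
separates the variables except for one power of `|1 - conj v * u|`, which `exists_power_split`
handles. -/
theorem bidens_mob_left_le {α β θ ϑ : ℝ} (h : Admissible α β θ ϑ) :
    ∃ C s y p : ℝ, 0 ≤ C ∧ -1 < s ∧ -1 < y ∧ 0 ≤ p ∧ p < 1 ∧
      ∀ u ∈ disk, ∀ v ∈ disk, bidens α β θ ϑ (mob v u, v) ≤
        C * (dens s v * (dens y u * (‖u‖ ^ (2 * θ) * ‖1 - conj v * u‖ ^ (-p)))) := by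
  obtain ⟨C, x, y, p, hC, hx, hy, hp0, hp1, hle⟩ := exists_power_split h
  have hα := h.alpha
  have hβ := h.beta
  have hs := h.sum
  set S := α + β + 2 * θ + 2 * ϑ + 2 with hS
  have hα1 : 0 < α + 1 := by linarith
  have hβ1 : 0 < β + 1 := by linarith
  have hy1 : 0 < α - y + 1 := by linarith
  have hx1 : 0 < S - x + 1 := by linarith
  have hS1 : 0 < S + 1 := by linarith
  have hpi := Real.pi_pos
  refine ⟨C * ((β + 1) / (S + 1)) * ((α + 1) / (α - y + 1)) * ((S + 1) / (S - x + 1)),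
    S - x, α - y, p, by positivity, by linarith, by linarith, hp0, hp1, fun u hu v hv => ?_⟩
  have h0 : (0 : ℂ) ∈ disk := by simp [disk]
  have e1 := bidens_mob (α := α) (β := β) (θ := θ) (ϑ := ϑ) hv hu h0
  rw [mob_zero] at e1
  have e2 : bidens α β θ ϑ (u, 0) = dens α u * ((β + 1) / Real.pi) * ‖u‖ ^ (2 * θ) := by
    simp [bidens, dens, weight, defect]
  have e3 : dens S v = (S + 1) / Real.pi * defect v ^ (α + β + 2 * θ + 2 * ϑ + 4) := by
    rw [dens]; congr 2; rw [hS]; ring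
  have e4 : defect v ^ (α + β + 2 * θ + 2 * ϑ + 4) = Real.pi / (S + 1) * dens S v := by
    rw [e3]; field_simp
  have hdu := dens_pos hα hu
  have hdv := dens_pos (by linarith : -1 < S) hv
  rw [e1, e2, e4]
  simp only [mul_zero, sub_zero, norm_one, Real.one_rpow, mul_one]
  have e5 := dens_mul_rpow (α := S) (x := x) hv hS1.ne' hx1.ne'
  have e6 := dens_mul_rpow (α := α) (x := y) hu hα1.ne' hy1.ne'
  calc Real.pi / (S + 1) * dens S v * ‖1 - conj v * u‖ ^ (-(2 * (α + θ + ϑ + 2))) *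
        (dens α u * ((β + 1) / Real.pi) * ‖u‖ ^ (2 * θ))
      ≤ Real.pi / (S + 1) * dens S v *
        (C * (‖1 - conj v * u‖ ^ (-p) * defect v ^ (-x) * defect u ^ (-y))) *
        (dens α u * ((β + 1) / Real.pi) * ‖u‖ ^ (2 * θ)) := by
        have := hle u hu v hv
        gcongr
    _ = C * ((β + 1) / (S + 1)) * ((dens S v * defect v ^ (-x)) *
        ((dens α u * defect u ^ (-y)) * (‖u‖ ^ (2 * θ) * ‖1 - conj v * u‖ ^ (-p)))) := by
        field_simp
    _ = _ := by rw [e5, e6]; ring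

theorem lintegral_dA (α : ℝ) {g : ℂ → ℝ≥0∞} (hg : Measurable g) :
    ∫⁻ z, g z ∂dA α = ∫⁻ z, ENNReal.ofReal (dens α z) * g z ∂hyp := by
  rw [dA_eq, lintegral_withDensity_eq_lintegral_mul _ (measurable_dens α).ennreal_ofReal hg]
  rfl

theorem measurable_rpow_mul_rpow (θ p : ℝ) : Measurable fun q : ℂ × ℂ =>
    ENNReal.ofReal (‖q.2‖ ^ (2 * θ)) * ENNReal.ofReal (‖1 - conj q.1 * q.2‖ ^ (-p)) := by
  have hconj : Measurable (conj : ℂ → ℂ) := Complex.continuous_conj.measurable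
  fun_prop

/-- Integrating in `v` first costs only a constant; then `|u|^(2θ)` is integrable because `2θ > -2`.
-/
theorem lintegral_lintegral_rpow_lt_top {s y θ p : ℝ} (hs : -1 < s) (hy : -1 < y) (hθ : -1 < θ)
    (hp0 : 0 ≤ p) (hp1 : p < 1) :
    ∫⁻ v, ∫⁻ u, ENNReal.ofReal (‖u‖ ^ (2 * θ)) * ENNReal.ofReal (‖1 - conj v * u‖ ^ (-p))
      ∂dA y ∂dA s < ∞ := by
  have hconj : Measurable (conj : ℂ → ℂ) := Complex.continuous_conj.measurable
  have hfin := lintegral_norm_rpow_dA (x := 2 * θ) (by linarith) hy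
  rw [lintegral_lintegral_swap (measurable_rpow_mul_rpow θ p).aemeasurable]
  have hk : Measurable fun u : ℂ => ENNReal.ofReal (‖u‖ ^ (2 * θ)) := by fun_prop
  refine lt_of_le_of_lt (b := ∫⁻ u, ENNReal.ofReal (‖u‖ ^ (2 * θ)) *
    ENNReal.ofReal (Real.cos (p * (Real.pi / 2)))⁻¹ ∂dA y) (lintegral_mono_ae ?_) ?_
  · filter_upwards [dA_ae_mem y] with u hu
    rw [lintegral_const_mul' _ _ ENNReal.ofReal_ne_top]
    exact mul_le_mul_right (lintegral_norm_one_sub_rpow hs hp0 hp1 hu) _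
  · rw [lintegral_mul_const _ hk]
    exact ENNReal.mul_lt_top hfin ENNReal.ofReal_lt_top

/-- For fixed `v` the substitution `u ↦ mob v u` preserves `hyp` and moves the singularity from `u =
v` to `u = 0`. -/
theorem lintegral_bidens_lt_top {α β θ ϑ : ℝ} (h : Admissible α β θ ϑ) :
    ∫⁻ z, ENNReal.ofReal (bidens α β θ ϑ z) ∂hyp.prod hyp < ∞ := by
  obtain ⟨C, s, y, p, hC, hs, hy, hp0, hp1, hle⟩ := bidens_mob_left_le h
  have hm := (measurable_bidens α β θ ϑ).ennreal_ofReal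
  have hmk := measurable_rpow_mul_rpow θ p
  rw [lintegral_prod_symm' _ hm]
  have step1 : ∀ᵐ v ∂hyp, ∫⁻ u, ENNReal.ofReal (bidens α β θ ϑ (u, v)) ∂hyp ≤
      ENNReal.ofReal C * (ENNReal.ofReal (dens s v) * ∫⁻ u, ENNReal.ofReal (‖u‖ ^ (2 * θ)) *
        ENNReal.ofReal (‖1 - conj v * u‖ ^ (-p)) ∂dA y) := by
    filter_upwards [hyp_ae_mem] with v hv
    have h1 : Measurable fun u : ℂ => ENNReal.ofReal (bidens α β θ ϑ (u, v)) :=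
      hm.comp measurable_prodMk_right
    have h2 : Measurable fun u : ℂ =>
        ENNReal.ofReal (‖u‖ ^ (2 * θ)) * ENNReal.ofReal (‖1 - conj v * u‖ ^ (-p)) := by
      fun_prop
    calc ∫⁻ u, ENNReal.ofReal (bidens α β θ ϑ (u, v)) ∂hyp
        = ∫⁻ u, ENNReal.ofReal (bidens α β θ ϑ (mob v u, v)) ∂hyp :=
          ((measurePreserving_mob hv).lintegral_comp h1).symm
      _ ≤ ∫⁻ u, ENNReal.ofReal C * (ENNReal.ofReal (dens s v) * (ENNReal.ofReal (dens y u) *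
          (ENNReal.ofReal (‖u‖ ^ (2 * θ)) * ENNReal.ofReal (‖1 - conj v * u‖ ^ (-p))))) ∂hyp := by
        refine lintegral_mono_ae ?_
        filter_upwards [hyp_ae_mem] with u hu
        have h3 := dens_pos hs hv
        have h4 := dens_pos hy hu
        rw [← ENNReal.ofReal_mul (by positivity), ← ENNReal.ofReal_mul h4.le,
          ← ENNReal.ofReal_mul h3.le, ← ENNReal.ofReal_mul hC]
        exact ENNReal.ofReal_le_ofReal (hle u hu v hv)
      _ = _ := by
        rw [lintegral_const_mul' _ _ ENNReal.ofReal_ne_top,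
          lintegral_const_mul' _ _ ENNReal.ofReal_ne_top, lintegral_dA y h2]
  have hmi : Measurable fun v : ℂ => ∫⁻ u, ENNReal.ofReal (‖u‖ ^ (2 * θ)) *
      ENNReal.ofReal (‖1 - conj v * u‖ ^ (-p)) ∂dA y := hmk.lintegral_prod_right'
  refine lt_of_le_of_lt (lintegral_mono_ae step1) ?_
  rw [lintegral_const_mul' _ _ ENNReal.ofReal_ne_top,
    ← lintegral_dA s hmi]
  exact ENNReal.mul_lt_top ENNReal.ofReal_lt_top
    (lintegral_lintegral_rpow_lt_top hs hy h.theta hp0 hp1)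

theorem isFiniteMeasure_bidiskMeasure {α β θ ϑ : ℝ} (h : Admissible α β θ ϑ) :
    IsFiniteMeasure (bidiskMeasure α β θ ϑ) := by
  refine ⟨?_⟩
  rw [bidiskMeasure_eq θ ϑ h.alpha h.beta, withDensity_apply _ MeasurableSet.univ,
    Measure.restrict_univ]
  exact lintegral_bidens_lt_top h

theorem integrable_weight {α β θ ϑ : ℝ} (h : Admissible α β θ ϑ) :
    Integrable (weight θ ϑ) ((dA α).prod (dA β)) := by
  have hfin := (isFiniteMeasure_bidiskMeasure h).measure_univ_lt_top
  rw [bidiskMeasure, withDensity_apply _ MeasurableSet.univ, Measure.restrict_univ] at hfin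
  refine ⟨(measurable_weight θ ϑ).aestronglyMeasurable, ?_⟩
  rw [hasFiniteIntegral_iff_ofReal (Eventually.of_forall (weight_nonneg θ ϑ))]
  exact hfin

theorem sigma_eq_inv {α β θ ϑ : ℝ} :
    sigma α β θ ϑ = ((bidiskMeasure α β θ ϑ).real univ)⁻¹ := by
  rw [sigma, integral_eq_lintegral_of_nonneg_ae (Eventually.of_forall (weight_nonneg θ ϑ))
    (measurable_weight θ ϑ).aestronglyMeasurable, Measure.real, bidiskMeasure,
    withDensity_apply _ MeasurableSet.univ, Measure.restrict_univ]

/-! ### Comparison with Lebesgue measure -/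

/-- The density of `bidiskMeasure` with respect to Lebesgue measure. -/
def vdens (α β θ ϑ : ℝ) (z : ℂ × ℂ) : ℝ :=
  (defect z.1 ^ 2)⁻¹ * (defect z.2 ^ 2)⁻¹ * bidens α β θ ϑ z

theorem measurable_vdens (α β θ ϑ : ℝ) : Measurable (vdens α β θ ϑ) := by
  have := continuous_defect.measurable
  have := measurable_bidens α β θ ϑ
  unfold vdens
  fun_prop

theorem bidiskMeasure_eq_volume {α β : ℝ} (θ ϑ : ℝ) (hα : -1 < α) (hβ : -1 < β) :
    bidiskMeasure α β θ ϑ =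
      (volume.restrict bidisk).withDensity fun z => ENNReal.ofReal (vdens α β θ ϑ z) := by
  have h1 := measurable_hyp_density
  have h4 : Measurable fun z : ℂ × ℂ =>
      ENNReal.ofReal ((defect z.1 ^ 2)⁻¹) * ENNReal.ofReal ((defect z.2 ^ 2)⁻¹) :=
    (h1.comp measurable_fst).mul (h1.comp measurable_snd)
  rw [bidiskMeasure_eq θ ϑ hα hβ, hyp, prod_withDensity h1 h1, Measure.prod_restrict,
    ← Measure.volume_eq_prod, ← bidisk_eq_prod,
    ← withDensity_mul _ h4 (measurable_bidens α β θ ϑ).ennreal_ofReal]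
  refine withDensity_congr_ae (Eventually.of_forall fun z => ?_)
  simp only [Pi.mul_apply, vdens]
  rw [← ENNReal.ofReal_mul (by positivity), ← ENNReal.ofReal_mul (by positivity)]

theorem vdens_pos {α β θ ϑ : ℝ} (hα : -1 < α) (hβ : -1 < β) {z : ℂ × ℂ} (hz : z ∈ bidisk)
    (hne : z.1 ≠ z.2) : 0 < vdens α β θ ϑ z := by
  have h1 := defect_pos hz.1
  have h2 := defect_pos hz.2
  have h3 := dens_pos hα hz.1
  have h4 := dens_pos hβ hz.2
  have h5 : 0 < ‖1 - conj z.2 * z.1‖ := norm_pos_iff.2 (one_sub_ne_zero hz.2 (le_of_lt hz.1))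
  have h6 : 0 < ‖z.1 - z.2‖ := norm_pos_iff.2 (sub_ne_zero.2 hne)
  unfold vdens bidens weight
  positivity

theorem continuousOn_vdens (α β θ ϑ : ℝ) :
    ContinuousOn (vdens α β θ ϑ) (bidisk ∩ {z | z.1 ≠ z.2}) := by
  have hd := continuous_defect
  intro z hz
  have h1 := defect_pos hz.1.1
  have h2 := defect_pos hz.1.2
  have h5 : 0 < ‖1 - conj z.2 * z.1‖ := norm_pos_iff.2 (one_sub_ne_zero hz.1.2 (le_of_lt hz.1.1))
  have h6 : 0 < ‖z.1 - z.2‖ := norm_pos_iff.2 (sub_ne_zero.2 hz.2)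
  refine ContinuousAt.continuousWithinAt ?_
  have c1 : ContinuousAt (fun z : ℂ × ℂ => defect z.1) z := by fun_prop
  have c2 : ContinuousAt (fun z : ℂ × ℂ => defect z.2) z := by fun_prop
  have c3 : ContinuousAt (fun z : ℂ × ℂ => ‖1 - conj z.2 * z.1‖) z := by
    have := Complex.continuous_conj
    fun_prop
  have c4 : ContinuousAt (fun z : ℂ × ℂ => ‖z.1 - z.2‖) z := by fun_prop
  unfold vdens bidens weight dens
  exact (((c1.pow 2).inv₀ (pow_ne_zero 2 h1.ne')).mul ((c2.pow 2).inv₀ (pow_ne_zero 2 h2.ne'))).mul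
    (((continuousAt_const.mul (c1.rpow_const (Or.inl h1.ne'))).mul
      (continuousAt_const.mul (c2.rpow_const (Or.inl h2.ne')))).mul
      ((c3.rpow_const (Or.inl h5.ne')).mul (c4.rpow_const (Or.inl h6.ne'))))

theorem ae_ne_diag : ∀ᵐ z : ℂ × ℂ, z.1 ≠ z.2 := by
  have hm : MeasurableSet {z : ℂ × ℂ | z.1 = z.2} :=
    (isClosed_eq continuous_fst continuous_snd).measurableSet
  have : (volume : Measure (ℂ × ℂ)) {z : ℂ × ℂ | z.1 = z.2} = 0 := by
    rw [Measure.volume_eq_prod, Measure.measure_prod_null hm]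
    refine Eventually.of_forall fun x => ?_
    have : Prod.mk x ⁻¹' {z : ℂ × ℂ | z.1 = z.2} = {x} := by
      ext y; simp [eq_comm]
    change volume (Prod.mk x ⁻¹' {z : ℂ × ℂ | z.1 = z.2}) = 0
    rw [this]
    simp
  rw [ae_iff]
  simpa using this

/-- The density is positive off the diagonal, which is a null set. This makes holomorphic
representatives unique and the total mass positive. -/
theorem restrict_absolutelyContinuous {α β : ℝ} (θ ϑ : ℝ) (hα : -1 < α) (hβ : -1 < β) :
    (volume.restrict bidisk : Measure (ℂ × ℂ)) ≪ bidiskMeasure α β θ ϑ := by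
  rw [bidiskMeasure_eq_volume θ ϑ hα hβ]
  refine withDensity_absolutelyContinuous' (measurable_vdens α β θ ϑ).ennreal_ofReal.aemeasurable ?_
  filter_upwards [ae_restrict_mem isOpen_bidisk.measurableSet, ae_restrict_of_ae ae_ne_diag]
    with z hz hne
  simpa using vdens_pos hα hβ hz hne

theorem bidiskMeasure_absolutelyContinuous (α β θ ϑ : ℝ) (hα : -1 < α) (hβ : -1 < β) :
    bidiskMeasure α β θ ϑ ≪ volume.restrict bidisk := by
  rw [bidiskMeasure_eq_volume θ ϑ hα hβ]
  exact withDensity_absolutelyContinuous _ _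

theorem bidiskMeasure_real_univ_pos {α β θ ϑ : ℝ} (h : Admissible α β θ ϑ) :
    0 < (bidiskMeasure α β θ ϑ).real univ := by
  have := isFiniteMeasure_bidiskMeasure h
  have hne : bidiskMeasure α β θ ϑ univ ≠ 0 := by
    intro h0
    have h1 := restrict_absolutelyContinuous θ ϑ h.alpha h.beta h0
    rw [Measure.restrict_apply_univ] at h1
    exact (isOpen_bidisk.measure_pos volume ⟨0, by simp [bidisk]⟩).ne' h1
  exact ENNReal.toReal_pos hne (measure_ne_top _ _)

theorem sigma_pos {α β θ ϑ : ℝ} (h : Admissible α β θ ϑ) : 0 < sigma α β θ ϑ := by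
  rw [sigma_eq_inv]
  exact inv_pos.2 (bidiskMeasure_real_univ_pos h)

/-! ### Holomorphic functions of two variables -/

theorem differentiableAt_fst_section {f : ℂ × ℂ → ℂ} {z : ℂ × ℂ} (h : DifferentiableAt ℂ f z) :
    DifferentiableAt ℂ (fun x => f (x, z.2)) z.1 := by
  have h' : DifferentiableAt ℂ f ((fun x : ℂ => (x, z.2)) z.1) := h
  exact DifferentiableAt.comp z.1 h' (by fun_prop)

theorem differentiableAt_snd_section {f : ℂ × ℂ → ℂ} {z : ℂ × ℂ} (h : DifferentiableAt ℂ f z) :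
    DifferentiableAt ℂ (fun y => f (z.1, y)) z.2 := by
  have h' : DifferentiableAt ℂ f ((fun y : ℂ => (z.1, y)) z.2) := h
  exact DifferentiableAt.comp z.2 h' (by fun_prop)

/-- By continuity of `f` the slices converge locally uniformly as the second coordinate moves, hence
so do their complex derivatives. -/
theorem continuousAt_deriv_fst {U : Set (ℂ × ℂ)} (hU : IsOpen U) {f : ℂ × ℂ → ℂ}
    (hc : ContinuousOn f U)
    (h1 : ∀ z ∈ U, DifferentiableAt ℂ (fun x => f (x, z.2)) z.1) {z : ℂ × ℂ} (hz : z ∈ U) :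
    ContinuousAt (fun v : ℂ × ℂ => deriv (fun x => f (x, v.2)) v.1) z := by
  obtain ⟨ε, hε, hball⟩ := Metric.isOpen_iff.1 hU z hz
  have hmem : ∀ x ∈ ball z.1 ε, ∀ y ∈ ball z.2 ε, (x, y) ∈ U := fun x hx y hy => by
    refine hball ?_
    rw [mem_ball, Prod.dist_eq]
    exact max_lt hx hy
  have hev : ∀ᶠ v : ℂ × ℂ in 𝓝 z, v.2 ∈ ball z.2 ε :=
    continuousAt_snd.eventually (ball_mem_nhds _ hε)
  have hlim : TendstoLocallyUniformlyOn (fun (v : ℂ × ℂ) (x : ℂ) => f (x, v.2))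
      (fun x => f (x, z.2)) (𝓝 z) (ball z.1 ε) := by
    rw [Metric.tendstoLocallyUniformlyOn_iff]
    intro δ hδ x hx
    have hcx : ContinuousAt f (x, z.2) :=
      hc.continuousAt (hU.mem_nhds (hmem x hx z.2 (mem_ball_self hε)))
    have hnear := Metric.continuousAt_iff.1 hcx (δ / 2) (half_pos hδ)
    obtain ⟨η, hη, hnear⟩ := hnear
    refine ⟨ball x η, mem_nhdsWithin_of_mem_nhds (ball_mem_nhds _ hη), ?_⟩
    filter_upwards [continuousAt_snd.eventually (ball_mem_nhds z.2 hη)] with v hv y hy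
    have e1 : dist (f (y, z.2)) (f (x, z.2)) < δ / 2 := hnear (by
      rw [Prod.dist_eq]; exact max_lt hy (by simpa using hη))
    have e2 : dist (f (y, v.2)) (f (x, z.2)) < δ / 2 := hnear (by
      rw [Prod.dist_eq]; exact max_lt hy hv)
    calc _ ≤ _ := dist_triangle_right _ _ (f (x, z.2))
      _ < δ := by linarith
  have hd : ∀ᶠ v : ℂ × ℂ in 𝓝 z, DifferentiableOn ℂ (fun x : ℂ => f (x, v.2)) (ball z.1 ε) := by
    filter_upwards [hev] with v hv x hx
    exact (h1 (x, v.2) (hmem x hx _ hv)).differentiableWithinAt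
  have hderiv := hlim.deriv hd isOpen_ball
  have hself := mem_ball_self (x := z.1) hε
  have hdz : DifferentiableOn ℂ (fun x : ℂ => f (x, z.2)) (ball z.1 ε) := hd.self_of_nhds
  have hcont : ContinuousWithinAt (deriv fun x : ℂ => f (x, z.2)) (ball z.1 ε) z.1 :=
    (hdz.deriv isOpen_ball).continuousOn _ hself
  refine hderiv.tendsto_comp hcont hself (g := fun v : ℂ × ℂ => v.1) ?_
  rw [isOpen_ball.nhdsWithin_eq hself]
  exact continuousAt_fst

/-- Continuous partial derivatives give strict differentiability. Strictness is what controls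
difference quotients with two moving end points in `exists_eq_sub_mul`. -/
theorem hasStrictFDerivAt_of_separately {U : Set (ℂ × ℂ)} (hU : IsOpen U) {f : ℂ × ℂ → ℂ}
    (hc : ContinuousOn f U)
    (h1 : ∀ z ∈ U, DifferentiableAt ℂ (fun x => f (x, z.2)) z.1)
    (h2 : ∀ z ∈ U, DifferentiableAt ℂ (fun y => f (z.1, y)) z.2) {z : ℂ × ℂ} (hz : z ∈ U) :
    HasStrictFDerivAt f ((ContinuousLinearMap.toSpanSingleton ℂ
      (deriv (fun x => f (x, z.2)) z.1)).coprod (ContinuousLinearMap.toSpanSingleton ℂ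
      (deriv (fun y => f (z.1, y)) z.2))) z := by
  have c1 := continuousAt_deriv_fst hU hc h1 hz
  have c2 : ContinuousAt (fun v : ℂ × ℂ => deriv (fun y => f (v.1, y)) v.2) z := by
    have hs : ContinuousOn (f ∘ Prod.swap) (Prod.swap ⁻¹' U) :=
      hc.comp continuous_swap.continuousOn fun _ h => h
    have := continuousAt_deriv_fst (hU.preimage continuous_swap) hs
      (fun w hw => h2 w.swap hw) (z := z.swap) (by simpa using hz)
    exact ContinuousAt.comp (x := z) (g := fun v : ℂ × ℂ =>
      deriv (fun x => (f ∘ Prod.swap) (x, v.2)) v.1) this continuous_swap.continuousAt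
  have hL : Continuous fun c : ℂ => ContinuousLinearMap.toSpanSingleton ℂ c :=
    (ContinuousLinearMap.toSpanSingletonLE ℂ ℂ ℂ).toLinearMap.continuous_of_finiteDimensional
  have hev := hU.eventually_mem hz
  exact hasStrictFDerivAt_uncurry_coprod (u := z) (f := fun x y => f (x, y))
    (f₁ := fun x y => ContinuousLinearMap.toSpanSingleton ℂ (deriv (fun t => f (t, y)) x))
    (f₂ := fun x y => ContinuousLinearMap.toSpanSingleton ℂ (deriv (fun t => f (x, t)) y))
    (hev.mono fun v hv => (h1 v hv).hasDerivAt.hasFDerivAt)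
    (hev.mono fun v hv => (h2 v hv).hasDerivAt.hasFDerivAt)
    (hL.continuousAt.comp c1) (hL.continuousAt.comp c2)

/-- Osgood's lemma. -/
theorem differentiableOn_of_separately {U : Set (ℂ × ℂ)} (hU : IsOpen U) {f : ℂ × ℂ → ℂ}
    (hc : ContinuousOn f U)
    (h1 : ∀ z ∈ U, DifferentiableAt ℂ (fun x => f (x, z.2)) z.1)
    (h2 : ∀ z ∈ U, DifferentiableAt ℂ (fun y => f (z.1, y)) z.2) : DifferentiableOn ℂ f U :=
  fun _ hz => (hasStrictFDerivAt_of_separately hU hc h1 h2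
    hz).hasFDerivAt.differentiableAt.differentiableWithinAt

/-- The one-variable Weierstrass theorem applies on each coordinate slice, and Osgood's lemma
reassembles the slices. -/
theorem differentiableOn_of_tendstoLocallyUniformlyOn {U : Set (ℂ × ℂ)} (hU : IsOpen U)
    {F : ℕ → ℂ × ℂ → ℂ} {f : ℂ × ℂ → ℂ} (hF : ∀ n, DifferentiableOn ℂ (F n) U)
    (h : TendstoLocallyUniformlyOn F f atTop U) : DifferentiableOn ℂ f U := by
  have hc : ContinuousOn f U :=
    h.continuousOn (Frequently.of_forall fun n => (hF n).continuousOn)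
  refine differentiableOn_of_separately hU hc (fun z hz => ?_) fun z hz => ?_
  · have hV : IsOpen ((fun x : ℂ => (x, z.2)) ⁻¹' U) := hU.preimage (by fun_prop)
    have h' := h.comp (fun x : ℂ => (x, z.2)) (t := (fun x : ℂ => (x, z.2)) ⁻¹' U)
      (fun _ hx => hx) (by fun_prop)
    refine (h'.differentiableOn (Eventually.of_forall fun n => ?_) hV).differentiableAt
      (hV.mem_nhds hz)
    exact (hF n).comp (by fun_prop) fun _ hx => hx
  · have hV : IsOpen ((fun y : ℂ => (z.1, y)) ⁻¹' U) := hU.preimage (by fun_prop)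
    have h' := h.comp (fun y : ℂ => (z.1, y)) (t := (fun y : ℂ => (z.1, y)) ⁻¹' U)
      (fun _ hx => hx) (by fun_prop)
    refine (h'.differentiableOn (Eventually.of_forall fun n => ?_) hV).differentiableAt
      (hV.mem_nhds hz)
    exact (hF n).comp (by fun_prop) fun _ hx => hx

theorem exists_eq_sub_mul {F : ℂ × ℂ → ℂ} (hF : DifferentiableOn ℂ F bidisk)
    (h0 : ∀ x ∈ disk, F (x, x) = 0) :
    ∃ G : ℂ × ℂ → ℂ, DifferentiableOn ℂ G bidisk ∧
      ∀ z ∈ bidisk, F z = (z.1 - z.2) * G z := by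
  have hat : ∀ z ∈ bidisk, DifferentiableAt ℂ F z := fun z hz =>
    hF.differentiableAt (isOpen_bidisk.mem_nhds hz)
  have h1 : ∀ z ∈ bidisk, DifferentiableAt ℂ (fun x => F (x, z.2)) z.1 := fun z hz =>
    differentiableAt_fst_section (hat z hz)
  have h2 : ∀ z ∈ bidisk, DifferentiableAt ℂ (fun y => F (z.1, y)) z.2 := fun z hz =>
    differentiableAt_snd_section (hat z hz)
  -- The quotient is extended to the diagonal by the partial derivative in the first variable;
  -- continuity and holomorphy in each variable then suffice.
  set G : ℂ × ℂ → ℂ := fun z => dslope (fun x => F (x, z.2)) z.2 z.1 with hG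
  have hGne : ∀ z ∈ bidisk, z.1 ≠ z.2 → G z = F z / (z.1 - z.2) := by
    intro z hz hne
    simp only [hG]
    rw [dslope_of_ne _ hne, slope_def_field, h0 _ hz.2, sub_zero]
  have hGeq : ∀ x, G (x, x) = deriv (fun t => F (t, x)) x := fun x => dslope_same _ _
  have hstrict : ∀ z ∈ bidisk, HasStrictFDerivAt F ((ContinuousLinearMap.toSpanSingleton ℂ
      (deriv (fun x => F (x, z.2)) z.1)).coprod (ContinuousLinearMap.toSpanSingleton ℂ
      (deriv (fun y => F (z.1, y)) z.2))) z := fun z hz =>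
    hasStrictFDerivAt_of_separately isOpen_bidisk hF.continuousOn h1 h2 hz
  -- The derivative of `F` along the diagonal vanishes. So either partial derivative, up to sign,
  -- extends the quotient, and `G` is also a `dslope` in the second variable.
  have hderiv0 : ∀ x ∈ disk, deriv (fun t => F (t, x)) x + deriv (fun t => F (x, t)) x = 0 := by
    intro x hx
    have hdiag : HasDerivAt (fun t : ℂ => (t, t)) (1, 1) x :=
      (hasDerivAt_id x).prodMk (hasDerivAt_id x)
    have e1 := HasFDerivAt.comp_hasDerivAt (f := fun t : ℂ => (t, t)) x
      (hstrict (x, x) ⟨hx, hx⟩).hasFDerivAt hdiag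
    have e2 : HasDerivAt (F ∘ fun t : ℂ => (t, t)) 0 x := by
      refine (hasDerivAt_const x (0 : ℂ)).congr_of_eventuallyEq ?_
      filter_upwards [isOpen_disk.mem_nhds hx] with t ht using h0 t ht
    have := e1.unique e2
    simpa using this
  refine ⟨G, differentiableOn_of_separately isOpen_bidisk ?_ ?_ ?_, ?_⟩
  · intro z hz
    refine ContinuousAt.continuousWithinAt ?_
    by_cases hne : z.1 = z.2
    · have hdz := continuousAt_deriv_fst isOpen_bidisk hF.continuousOn h1 hz
      have hz' : (z.2, z.2) = z := Prod.ext hne.symm rfl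
      have hGz : G z = deriv (fun x => F (x, z.2)) z.1 := by
        rw [hne, ← hGeq, hz']
      have hs := hstrict z hz
      rw [hasStrictFDerivAt_iff_isLittleO] at hs
      -- Strict differentiability is used between `v` and the diagonal point `(v.2, v.2)`, where `F`
      -- is zero.
      have hpair : Tendsto (fun v : ℂ × ℂ => (v, ((v.2, v.2) : ℂ × ℂ))) (𝓝 z) (𝓝 (z, z)) := by
        have : ContinuousAt (fun v : ℂ × ℂ => (v, ((v.2, v.2) : ℂ × ℂ))) z := by fun_prop
        have h3 := this.tendsto
        rwa [hz'] at h3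
      have hs2 := hs.comp_tendsto hpair
      rw [Metric.continuousAt_iff']
      intro ε hε
      have hs3 := hs2.def (half_pos hε)
      have hd3 := Metric.continuousAt_iff'.1 hdz ε hε
      filter_upwards [hs3, hd3, isOpen_bidisk.mem_nhds hz] with v hv hv2 hvU
      rw [hGz]
      by_cases hvne : v.1 = v.2
      · have : G v = deriv (fun x => F (x, v.2)) v.1 := by
          rw [hvne, ← hGeq]
          congr 1
          exact Prod.ext hvne rfl
        rw [this]
        exact hv2
      · rw [hGne v hvU hvne, dist_eq_norm]
        have hpos : 0 < ‖v.1 - v.2‖ := norm_pos_iff.2 (sub_ne_zero.2 hvne)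
        simp only [Function.comp, h0 _ hvU.2, sub_zero, ContinuousLinearMap.coprod_apply,
          ContinuousLinearMap.toSpanSingleton_apply, Prod.fst_sub, Prod.snd_sub, sub_self,
          smul_eq_mul, zero_mul, add_zero, Prod.norm_def, norm_zero] at hv
        rw [max_eq_left (norm_nonneg _)] at hv
        have hne0 := sub_ne_zero.2 hvne
        have : F v / (v.1 - v.2) - deriv (fun x => F (x, z.2)) z.1 =
            (F v - (v.1 - v.2) * deriv (fun x => F (x, z.2)) z.1) / (v.1 - v.2) := by
          rw [sub_div, mul_div_cancel_left₀ _ hne0]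
        rw [this, norm_div, div_lt_iff₀ hpos]
        nlinarith
    · have hcF : ContinuousAt F z := (hat z hz).continuousAt
      have hq : ContinuousAt (fun v : ℂ × ℂ => F v / (v.1 - v.2)) z :=
        hcF.div (by fun_prop) (sub_ne_zero.2 hne)
      refine hq.congr ?_
      have hopen : ∀ᶠ v : ℂ × ℂ in 𝓝 z, v.1 ≠ v.2 :=
        (isOpen_ne_fun continuous_fst continuous_snd).mem_nhds hne
      filter_upwards [hopen, isOpen_bidisk.mem_nhds hz] with v hv hvU using (hGne v hvU hv).symm
  · intro z hz
    have hd : DifferentiableOn ℂ (fun x => F (x, z.2)) disk := fun x hx =>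
      (h1 (x, z.2) ⟨hx, hz.2⟩).differentiableWithinAt
    have := (Complex.differentiableOn_dslope (isOpen_disk.mem_nhds hz.2)).2 hd
    exact this.differentiableAt (isOpen_disk.mem_nhds hz.1)
  · intro z hz
    have hd : DifferentiableOn ℂ (fun y => F (z.1, y)) disk := fun y hy =>
      (h2 (z.1, y) ⟨hz.1, hy⟩).differentiableWithinAt
    have hds := (Complex.differentiableOn_dslope (isOpen_disk.mem_nhds hz.1)).2 hd
    have hda := (hds.differentiableAt (isOpen_disk.mem_nhds hz.2)).neg
    refine hda.congr_of_eventuallyEq ?_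
    filter_upwards [isOpen_disk.mem_nhds hz.2] with y hy
    simp only [Pi.neg_apply]
    by_cases hne : y = z.1
    · rw [hne, dslope_same, hGeq]
      linear_combination hderiv0 z.1 hz.1
    · rw [dslope_of_ne _ hne, slope_def_field, hGne (z.1, y) ⟨hz.1, hy⟩ (Ne.symm hne),
        h0 _ hz.1, sub_zero, ← div_neg, neg_sub]
  · intro z hz
    by_cases hne : z.1 = z.2
    · rw [hne, sub_self, zero_mul, ← h0 z.2 hz.2]
      congr 1
      exact Prod.ext hne rfl
    · rw [hGne z hz hne, mul_div_cancel₀]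
      exact sub_ne_zero.2 hne

/-! ### Bounded point evaluations -/

theorem isOpen_bidisk_ne : IsOpen (bidisk ∩ {z : ℂ × ℂ | z.1 ≠ z.2}) :=
  isOpen_bidisk.inter (isOpen_ne_fun continuous_fst continuous_snd)

/-- Every point of the bidisk is the center of rotation invariant sets that stay away from the
diagonal after a small translation. -/
theorem exists_rotation_invariant_set {p₀ : ℂ × ℂ} (hp : p₀ ∈ bidisk) :
    ∃ ε > 0, ∃ R : ℝ, ∃ S K : Set (ℂ × ℂ), IsOpen S ∧ S.Nonempty ∧ S ⊆ ball 0 R ∧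
      (∀ c : ℂ, ‖c‖ = 1 → (fun ζ => c • ζ) ⁻¹' S = S) ∧ IsCompact K ∧
      K ⊆ bidisk ∩ {z | z.1 ≠ z.2} ∧ ∀ p ∈ ball p₀ ε,
        (∀ ζ ∈ ball (0 : ℂ × ℂ) R, p + ζ ∈ bidisk) ∧ ∀ ζ ∈ S, p + ζ ∈ K := by
  by_cases hne : p₀.1 = p₀.2
  · obtain ⟨a, b⟩ := p₀
    simp only at hne
    subst hne
    have ha : ‖a‖ < 1 := hp.1
    set δ := (1 - ‖a‖) / 8 with hδ
    have hδ0 : 0 < δ := by rw [hδ]; linarith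
    -- A disk times an annulus: when the center moves by less than `δ/2`, the first coordinate stays
    -- within `3δ/2` of `a` and the second at distance between `5δ/2` and `9δ/2`, so they never
    -- meet. All of this fits in the bidisk because `8δ = 1 - ‖a‖`.
    refine ⟨δ / 2, by positivity, 4 * δ, ball 0 δ ×ˢ (ball 0 (4 * δ) \ closedBall 0 (3 * δ)),
      closedBall a (3 / 2 * δ) ×ˢ (closedBall a (9 / 2 * δ) \ ball a (5 / 2 * δ)), ?_, ?_, ?_, ?_,
      ?_, ?_, ?_⟩
    · exact isOpen_ball.prod (isOpen_ball.sdiff isClosed_closedBall)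
    · refine ⟨(0, ((7 / 2 * δ : ℝ) : ℂ)), ?_, ?_, ?_⟩
      · simpa using hδ0
      · rw [mem_ball_zero_iff, Complex.norm_real, Real.norm_of_nonneg (by positivity)]
        linarith
      · rw [mem_closedBall_zero_iff, Complex.norm_real, Real.norm_of_nonneg (by positivity)]
        linarith
    · rintro ⟨x, y⟩ ⟨h1, h2, -⟩
      simp only [mem_ball_zero_iff, Prod.norm_def] at h1 h2 ⊢
      exact max_lt (by linarith) h2
    · intro c hc
      ext ⟨x, y⟩
      simp [hc]
    · exact (isCompact_closedBall _ _).prod ((isCompact_closedBall _ _).diff isOpen_ball)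
    · rintro ⟨x, y⟩ ⟨h1, h2, h3⟩
      simp only [mem_closedBall, mem_ball, not_lt] at h1 h2 h3
      refine ⟨⟨?_, ?_⟩, ?_⟩
      · have := norm_le_norm_add_norm_sub' x a
        rw [← dist_eq_norm] at this
        change ‖x‖ < 1
        linarith
      · have := norm_le_norm_add_norm_sub' y a
        rw [← dist_eq_norm] at this
        change ‖y‖ < 1
        linarith
      · rintro (rfl : x = y)
        linarith
    · rintro ⟨p, q⟩ hpq
      rw [mem_ball, Prod.dist_eq, max_lt_iff] at hpq
      simp only [dist_eq_norm] at hpq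
      refine ⟨?_, ?_⟩
      · rintro ⟨x, y⟩ hxy
        simp only [mem_ball_zero_iff, Prod.norm_def, max_lt_iff] at hxy
        constructor
        · have e1 : p + x = a + (p - a) + x := by ring
          have := norm_add₃_le (a := a) (b := p - a) (c := x)
          change ‖p + x‖ < 1
          rw [e1]
          linarith [hpq.1, hxy.1]
        · have e1 : q + y = a + (q - a) + y := by ring
          have := norm_add₃_le (a := a) (b := q - a) (c := y)
          change ‖q + y‖ < 1
          rw [e1]
          linarith [hpq.2, hxy.2]
      · rintro ⟨x, y⟩ ⟨hx, hy1, hy2⟩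
        simp only [mem_ball_zero_iff, mem_closedBall_zero_iff, not_le] at hx hy1 hy2
        have e1 : p + x - a = (p - a) + x := by ring
        have e2 : q + y - a = (q - a) + y := by ring
        refine ⟨?_, ?_, ?_⟩
        · have := norm_add_le (p - a) x
          rw [mem_closedBall, dist_eq_norm]
          change ‖p + x - a‖ ≤ _
          rw [e1]
          linarith [hpq.1]
        · have := norm_add_le (q - a) y
          rw [mem_closedBall, dist_eq_norm]
          change ‖q + y - a‖ ≤ _
          rw [e2]
          linarith [hpq.2]
        · have := norm_sub_le ((q - a) + y) (q - a)
          rw [add_sub_cancel_left] at this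
          rw [mem_ball, dist_eq_norm, not_lt]
          change _ ≤ ‖q + y - a‖
          rw [e2]
          linarith [hpq.2]
  · obtain ⟨δ, hδ, hsub⟩ := Metric.nhds_basis_closedBall.mem_iff.1
      (isOpen_bidisk_ne.mem_nhds ⟨hp, hne⟩)
    have key : ∀ p ∈ ball p₀ (δ / 2), ∀ ζ ∈ ball (0 : ℂ × ℂ) (δ / 2), p + ζ ∈ closedBall p₀ δ := by
      intro p hp ζ hζ
      rw [mem_ball, dist_eq_norm] at hp
      rw [mem_ball_zero_iff] at hζ
      have := norm_add_le (p - p₀) ζ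
      rw [mem_closedBall, dist_eq_norm, show p + ζ - p₀ = (p - p₀) + ζ by abel]
      linarith
    refine ⟨δ / 2, by positivity, δ / 2, ball 0 (δ / 2), closedBall p₀ δ, isOpen_ball,
      ⟨0, by simpa using hδ⟩, subset_rfl, ?_, isCompact_closedBall _ _, hsub, ?_⟩
    · intro c hc
      ext ζ
      simp [norm_smul, hc]
    · exact fun p hp => ⟨fun ζ hζ => (hsub (key p hp ζ hζ)).1, fun ζ hζ => key p hp ζ hζ⟩

theorem measurePreserving_smul_volume {c : ℂ} (hc : ‖c‖ = 1) :
    MeasurePreserving (fun z : ℂ × ℂ => c • z) volume volume :=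
  (measurePreserving_rotation hc).prod (measurePreserving_rotation hc)

/-- Off the diagonal the density is continuous and positive, so it has a positive minimum on the
compact set `K`; the constant is its inverse. -/
theorem exists_restrict_le {α β : ℝ} (θ ϑ : ℝ) (hα : -1 < α) (hβ : -1 < β) {K : Set (ℂ × ℂ)}
    (hK : IsCompact K) (hne : K.Nonempty) (hsub : K ⊆ bidisk ∩ {z | z.1 ≠ z.2}) :
    ∃ m : ℝ≥0, (volume.restrict K : Measure (ℂ × ℂ)) ≤ (m : ℝ≥0∞) • bidiskMeasure α β θ ϑ := by
  obtain ⟨z₀, hz₀, hmin⟩ := hK.exists_isMinOn hne ((continuousOn_vdens α β θ ϑ).mono hsub)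
  set m := vdens α β θ ϑ z₀ with hm
  have hm0 : 0 < m := vdens_pos hα hβ (hsub hz₀).1 (hsub hz₀).2
  refine ⟨(m.toNNReal)⁻¹, ?_⟩
  rw [Measure.le_iff]
  intro s hs
  have hKm := hK.isClosed.measurableSet
  have h1 : ENNReal.ofReal m * (volume.restrict K : Measure (ℂ × ℂ)) s ≤
      bidiskMeasure α β θ ϑ s := by
    rw [bidiskMeasure_eq_volume θ ϑ hα hβ, withDensity_apply _ hs, Measure.restrict_restrict hs,
      Measure.restrict_apply hs, ← setLIntegral_const]
    calc ∫⁻ _ in s ∩ K, ENNReal.ofReal m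
        ≤ ∫⁻ z in s ∩ K, ENNReal.ofReal (vdens α β θ ϑ z) := by
          refine setLIntegral_mono' (hs.inter hKm) fun z hz => ?_
          exact ENNReal.ofReal_le_ofReal (hmin hz.2)
      _ ≤ _ := lintegral_mono_set (inter_subset_inter_right _ fun z hz => (hsub hz).1)
  have hmn : m.toNNReal ≠ 0 := by simpa using hm0
  rw [Measure.smul_apply, smul_eq_mul, ENNReal.coe_inv hmn]
  rw [mul_comm, ← div_eq_mul_inv, ENNReal.le_div_iff_mul_le (Or.inl (by simpa using hm0))
    (Or.inl ENNReal.coe_ne_top), mul_comm]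
  exact h1

/-- The value `g p` is the mean of `g` over `p + S`, where `S` is rotation invariant and `p + S`
lies in a compact set away from the diagonal. There Hölder bounds the `L¹` norm by the `L²` norm,
and Lebesgue measure is dominated by the weighted measure. -/
theorem exists_local_bound {α β : ℝ} (θ ϑ : ℝ) (hα : -1 < α) (hβ : -1 < β) {p₀ : ℂ × ℂ}
    (hp : p₀ ∈ bidisk) :
    ∃ ε > 0, ∃ C : ℝ≥0, ∀ g : ℂ × ℂ → ℂ, DifferentiableOn ℂ g bidisk →
      ∀ p ∈ ball p₀ ε, ‖g p‖ₑ ≤ C * eLpNorm g 2 (bidiskMeasure α β θ ϑ) := by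
  obtain ⟨ε, hε, R, S, K, hSo, hSne, hSR, hSrot, hK, hKsub, hpS⟩ := exists_rotation_invariant_set hp
  have hKne : K.Nonempty := by
    obtain ⟨ζ, hζ⟩ := hSne
    exact ⟨p₀ + ζ, (hpS p₀ (mem_ball_self hε)).2 ζ hζ⟩
  obtain ⟨m, hm⟩ := exists_restrict_le (α := α) (β := β) θ ϑ hα hβ hK hKne hKsub
  have hKm := hK.isClosed.measurableSet
  have hS0 : volume S ≠ 0 := (hSo.measure_pos volume hSne).ne'
  have hStop : volume S ≠ ∞ := (measure_mono hSR).trans_lt measure_ball_lt_top |>.ne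
  set C : ℝ≥0∞ := (volume S)⁻¹ * ((m : ℝ≥0∞) ^ (1 / (2 : ℝ≥0∞)).toReal *
    (volume K) ^ (1 / (1 : ℝ≥0∞).toReal - 1 / (2 : ℝ≥0∞).toReal)) with hC
  have hCtop : C ≠ ∞ := by
    rw [hC]
    refine ENNReal.mul_ne_top (by simpa using hS0) (ENNReal.mul_ne_top ?_ ?_)
    · exact ENNReal.rpow_ne_top_of_nonneg (by positivity) ENNReal.coe_ne_top
    · exact ENNReal.rpow_ne_top_of_nonneg (by norm_num) hK.measure_lt_top.ne
  refine ⟨ε, hε, C.toNNReal, fun g hg p hpε => ?_⟩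
  obtain ⟨hball, hSK⟩ := hpS p hpε
  have hgK : ContinuousOn g K := hg.continuousOn.mono fun z hz => (hKsub hz).1
  have : IsFiniteMeasure (volume.restrict S : Measure (ℂ × ℂ)) := ⟨by simpa using hStop.lt_top⟩
  have hdiff : DifferentiableOn ℂ (fun ζ => g (p + ζ)) (ball 0 R) :=
    hg.comp (by fun_prop) hball
  obtain ⟨M, hM⟩ := hK.exists_bound_of_continuousOn hgK
  have hint : Integrable (fun ζ => g (p + ζ)) (volume.restrict S) := by
    refine Integrable.of_bound ?_ M ?_
    · exact (hdiff.continuousOn.mono hSR).aestronglyMeasurable hSo.measurableSet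
    · filter_upwards [ae_restrict_mem hSo.measurableSet] with ζ hζ using hM _ (hSK ζ hζ)
  have hmean := integral_eq_of_rotation (μ := volume.restrict S) (R := R) (fun c hc => by
      have := (measurePreserving_smul_volume hc).restrict_preimage hSo.measurableSet
      rwa [hSrot c hc] at this)
    (by filter_upwards [ae_restrict_mem hSo.measurableSet] with ζ hζ using hSR hζ) hdiff hint
  have h1 : volume S * ‖g p‖ₑ ≤ ∫⁻ z in K, ‖g z‖ₑ := by
    have e1 := congrArg (fun x : ℂ => ‖x‖ₑ) hmean
    simp only [add_zero, enorm_mul] at e1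
    have e2 : ‖(((volume.restrict S : Measure (ℂ × ℂ)).real univ : ℝ) : ℂ)‖ₑ = volume S := by
      rw [← ofReal_norm, Complex.norm_real, Real.norm_of_nonneg measureReal_nonneg, Measure.real,
        Measure.restrict_apply_univ, ENNReal.ofReal_toReal hStop]
    rw [e2] at e1
    rw [← e1]
    calc _ ≤ ∫⁻ ζ in S, ‖g (p + ζ)‖ₑ := enorm_integral_le_lintegral_enorm _
      _ ≤ ∫⁻ ζ, K.indicator (fun z => ‖g z‖ₑ) (p + ζ) := by
        rw [← lintegral_indicator hSo.measurableSet]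
        refine lintegral_mono fun ζ => ?_
        by_cases hζ : ζ ∈ S
        · rw [indicator_of_mem hζ, indicator_of_mem (hSK ζ hζ)]
        · rw [indicator_of_notMem hζ]; exact zero_le
      _ = ∫⁻ z in K, ‖g z‖ₑ := by
        have : (volume : Measure (ℂ × ℂ)).IsAddLeftInvariant := by
          rw [Measure.volume_eq_prod]; infer_instance
        rw [lintegral_add_left_eq_self (fun z => K.indicator (fun z => ‖g z‖ₑ) z) p,
          lintegral_indicator hKm]
  have h2 : ∫⁻ z in K, ‖g z‖ₑ ≤ eLpNorm g 2 (volume.restrict K) *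
      (volume K) ^ (1 / (1 : ℝ≥0∞).toReal - 1 / (2 : ℝ≥0∞).toReal) := by
    have := eLpNorm_le_eLpNorm_mul_rpow_measure_univ (p := 1) (q := 2)
      (μ := volume.restrict K) (by norm_num) (hgK.aestronglyMeasurable hKm)
    rwa [eLpNorm_one_eq_lintegral_enorm, Measure.restrict_apply_univ] at this
  have h3 : eLpNorm g 2 (volume.restrict K) ≤
      (m : ℝ≥0∞) ^ (1 / (2 : ℝ≥0∞)).toReal * eLpNorm g 2 (bidiskMeasure α β θ ϑ) := by
    refine (eLpNorm_mono_measure g hm).trans ?_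
    rw [eLpNorm_smul_measure_of_ne_top (by norm_num), smul_eq_mul]
  rw [ENNReal.coe_toNNReal hCtop, hC]
  calc ‖g p‖ₑ = (volume S)⁻¹ * (volume S * ‖g p‖ₑ) := by
        rw [← mul_assoc, ENNReal.inv_mul_cancel hS0 hStop, one_mul]
    _ ≤ (volume S)⁻¹ * (((m : ℝ≥0∞) ^ (1 / (2 : ℝ≥0∞)).toReal *
        eLpNorm g 2 (bidiskMeasure α β θ ϑ)) *
        (volume K) ^ (1 / (1 : ℝ≥0∞).toReal - 1 / (2 : ℝ≥0∞).toReal)) := by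
        exact mul_le_mul_right (h1.trans (h2.trans (mul_le_mul_left h3 _))) _
    _ = _ := by ring

/-! ### The Bergman space as a reproducing kernel Hilbert space -/

section Space

variable {α β θ ϑ : ℝ}

/-- The holomorphic representative of an element of the Bergman space. -/
def rep (f : bergmanSpace α β θ ϑ) : ℂ × ℂ → ℂ := f.2.choose

theorem differentiableOn_rep (f : bergmanSpace α β θ ϑ) : DifferentiableOn ℂ (rep f) bidisk :=
  f.2.choose_spec.1

theorem coe_ae_eq_rep (f : bergmanSpace α β θ ϑ) :
    (f : Lp ℂ 2 (bidiskMeasure α β θ ϑ)) =ᵐ[bidiskMeasure α β θ ϑ] rep f :=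
  f.2.choose_spec.2

/-- The element of the Bergman space given by a square integrable holomorphic function. -/
def ofFun (g : ℂ × ℂ → ℂ) (hg : DifferentiableOn ℂ g bidisk)
    (h2 : MemLp g 2 (bidiskMeasure α β θ ϑ)) : bergmanSpace α β θ ϑ :=
  ⟨h2.toLp g, g, hg, h2.coeFn_toLp⟩

theorem ofFun_ae_eq (g : ℂ × ℂ → ℂ) (hg : DifferentiableOn ℂ g bidisk)
    (h2 : MemLp g 2 (bidiskMeasure α β θ ϑ)) :
    (ofFun g hg h2 : Lp ℂ 2 (bidiskMeasure α β θ ϑ)) =ᵐ[bidiskMeasure α β θ ϑ] g :=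
  h2.coeFn_toLp

theorem eqOn_of_ae_eq (hα : -1 < α) (hβ : -1 < β) {g₁ g₂ : ℂ × ℂ → ℂ}
    (h₁ : DifferentiableOn ℂ g₁ bidisk) (h₂ : DifferentiableOn ℂ g₂ bidisk)
    (h : g₁ =ᵐ[bidiskMeasure α β θ ϑ] g₂) : EqOn g₁ g₂ bidisk :=
  Measure.eqOn_open_of_ae_eq ((restrict_absolutelyContinuous θ ϑ hα hβ).ae_le h) isOpen_bidisk
    h₁.continuousOn h₂.continuousOn

theorem enorm_eq_eLpNorm_rep (f : bergmanSpace α β θ ϑ) :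
    ‖f‖ₑ = eLpNorm (rep f) 2 (bidiskMeasure α β θ ϑ) := by
  rw [← eLpNorm_congr_ae (coe_ae_eq_rep f), ← Lp.enorm_def]
  rfl

theorem memLp_rep (f : bergmanSpace α β θ ϑ) : MemLp (rep f) 2 (bidiskMeasure α β θ ϑ) :=
  (memLp_congr_ae (coe_ae_eq_rep f)).1 (Lp.memLp _)

theorem inner_eq_integral (f g : bergmanSpace α β θ ϑ) :
    inner ℂ f g = ∫ z, conj (rep f z) * rep g z ∂bidiskMeasure α β θ ϑ := by
  rw [Submodule.coe_inner, L2.inner_def]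
  refine integral_congr_ae ?_
  filter_upwards [coe_ae_eq_rep f, coe_ae_eq_rep g] with x h1 h2
  rw [h1, h2, RCLike.inner_apply, mul_comm]

variable [ha : Fact (Admissible α β θ ϑ)]

theorem rep_eqOn {f : bergmanSpace α β θ ϑ} {g : ℂ × ℂ → ℂ} (hg : DifferentiableOn ℂ g bidisk)
    (h : (f : Lp ℂ 2 (bidiskMeasure α β θ ϑ)) =ᵐ[bidiskMeasure α β θ ϑ] g) :
    EqOn (rep f) g bidisk :=
  eqOn_of_ae_eq ha.out.alpha ha.out.beta (differentiableOn_rep f) hg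
    ((coe_ae_eq_rep f).symm.trans h)

theorem rep_add (f g : bergmanSpace α β θ ϑ) : EqOn (rep (f + g)) (rep f + rep g) bidisk :=
  rep_eqOn ((differentiableOn_rep f).add (differentiableOn_rep g))
    ((Lp.coeFn_add _ _).trans ((coe_ae_eq_rep f).add (coe_ae_eq_rep g)))

theorem rep_smul (c : ℂ) (f : bergmanSpace α β θ ϑ) : EqOn (rep (c • f)) (c • rep f) bidisk :=
  rep_eqOn ((differentiableOn_rep f).const_smul c)
    ((Lp.coeFn_smul _ _).trans ((coe_ae_eq_rep f).const_smul c))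

theorem rep_sub (f g : bergmanSpace α β θ ϑ) : EqOn (rep (f - g)) (rep f - rep g) bidisk :=
  rep_eqOn ((differentiableOn_rep f).sub (differentiableOn_rep g))
    ((Lp.coeFn_sub _ _).trans ((coe_ae_eq_rep f).sub (coe_ae_eq_rep g)))

theorem exists_local_bound_rep (α β θ ϑ : ℝ) [ha : Fact (Admissible α β θ ϑ)] {p₀ : ℂ × ℂ}
    (hp : p₀ ∈ bidisk) :
    ∃ ε > 0, ∃ C : ℝ≥0, ∀ f : bergmanSpace α β θ ϑ, ∀ p ∈ ball p₀ ε, ‖rep f p‖ ≤ C * ‖f‖ := by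
  obtain ⟨ε, hε, C, h⟩ := exists_local_bound θ ϑ ha.out.alpha ha.out.beta hp
  refine ⟨ε, hε, C, fun f p hpε => ?_⟩
  have h1 := h (rep f) (differentiableOn_rep f) p hpε
  rw [← enorm_eq_eLpNorm_rep, enorm_eq_nnnorm, enorm_eq_nnnorm, ← ENNReal.coe_mul,
    ENNReal.coe_le_coe] at h1
  exact_mod_cast h1

/-- By the local bounds, an `L²` limit of holomorphic functions is also a locally uniform limit of
the representatives, hence holomorphic; an almost everywhere convergent subsequence identifies the
two limits. -/
theorem isClosed_bergmanSpace :
    IsClosed (bergmanSpace α β θ ϑ : Set (Lp ℂ 2 (bidiskMeasure α β θ ϑ))) := by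
  refine IsSeqClosed.isClosed fun F f hF hf => ?_
  set G : ℕ → bergmanSpace α β θ ϑ := fun n => ⟨F n, hF n⟩ with hG
  have hcau : CauchySeq F := hf.cauchySeq
  have huc : ∀ p₀ ∈ bidisk, ∃ ε > 0, UniformCauchySeqOn (fun n => rep (G n)) atTop
      (ball p₀ ε ∩ bidisk) := by
    intro p₀ hp₀
    obtain ⟨ε, hε, C, hb⟩ := exists_local_bound_rep α β θ ϑ hp₀
    refine ⟨ε, hε, ?_⟩
    rw [Metric.uniformCauchySeqOn_iff]
    intro δ hδ
    obtain ⟨N, hN⟩ := Metric.cauchySeq_iff.1 hcau (δ / (C + 1)) (by positivity)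
    refine ⟨N, fun m hm n hn p hp => ?_⟩
    have h1 := hb (G m - G n) p hp.1
    rw [rep_sub _ _ hp.2] at h1
    have h2 : ‖G m - G n‖ < δ / (C + 1) := by
      have := hN m hm n hn
      rwa [dist_eq_norm] at this
    rw [lt_div_iff₀ (by positivity)] at h2
    rw [dist_eq_norm]
    have h3 := norm_nonneg (G m - G n)
    calc _ ≤ C * ‖G m - G n‖ := h1
      _ < δ := by nlinarith
  have hlim : ∀ p ∈ bidisk, ∃ l, Tendsto (fun n => rep (G n) p) atTop (𝓝 l) := by
    intro p hp
    obtain ⟨ε, hε, h⟩ := huc p hp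
    exact cauchySeq_tendsto_of_complete (h.cauchySeq ⟨mem_ball_self hε, hp⟩)
  choose! g hg using hlim
  have hunif : TendstoLocallyUniformlyOn (fun n => rep (G n)) g atTop bidisk := by
    intro u hu p hp
    obtain ⟨ε, hε, h⟩ := huc p hp
    have := h.tendstoUniformlyOn_of_tendsto fun x hx => hg x hx.2
    exact ⟨ball p ε ∩ bidisk, inter_mem (mem_nhdsWithin_of_mem_nhds (ball_mem_nhds _ hε))
      self_mem_nhdsWithin, this u hu⟩
  have hgd : DifferentiableOn ℂ g bidisk :=
    differentiableOn_of_tendstoLocallyUniformlyOn isOpen_bidisk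
      (fun n => differentiableOn_rep (G n)) hunif
  refine ⟨g, hgd, ?_⟩
  obtain ⟨ns, hns, hae⟩ := (tendstoInMeasure_of_tendsto_Lp hf).exists_seq_tendsto_ae
  have hall : ∀ᵐ x ∂bidiskMeasure α β θ ϑ, ∀ n, F n x = rep (G n) x :=
    ae_all_iff.2 fun n => coe_ae_eq_rep (G n)
  filter_upwards [hae, hall, bidiskMeasure_ae_mem α β θ ϑ] with x h1 h2 h3
  simp only [h2] at h1
  exact tendsto_nhds_unique h1 ((hg x h3).comp hns.tendsto_atTop)

instance : CompleteSpace (bergmanSpace α β θ ϑ) :=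
  isClosed_bergmanSpace.completeSpace_coe

/-- Point evaluation as a continuous functional. -/
def evalCLM (α β θ ϑ : ℝ) [Fact (Admissible α β θ ϑ)] (z : bidisk) :
    bergmanSpace α β θ ϑ →L[ℂ] ℂ :=
  LinearMap.mkContinuousOfExistsBound
    { toFun := fun f => rep f z
      map_add' := fun f g => rep_add f g z.2
      map_smul' := fun c f => rep_smul c f z.2 } <| by
    obtain ⟨ε, hε, C, h⟩ := exists_local_bound_rep α β θ ϑ z.2
    exact ⟨C, fun f => h f z (mem_ball_self hε)⟩

instance : RKHS ℂ (bergmanSpace α β θ ϑ) bidisk ℂ where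
  coeCLM := ContinuousLinearMap.pi fun z => evalCLM α β θ ϑ z
  coeCLM_injective := by
    intro f g h
    have h1 : EqOn (rep f) (rep g) bidisk := fun z hz => congrFun h ⟨z, hz⟩
    refine Subtype.ext (Lp.ext ?_)
    filter_upwards [coe_ae_eq_rep f, coe_ae_eq_rep g, bidiskMeasure_ae_mem α β θ ϑ]
      with x h2 h3 h4
    rw [h2, h3, h1 h4]

theorem coe_eq_rep (f : bergmanSpace α β θ ϑ) (z : bidisk) : f z = rep f z := rfl

/-- The reproducing kernel at the point `w`. -/
def ker (α β θ ϑ : ℝ) [Fact (Admissible α β θ ϑ)] (w : bidisk) : bergmanSpace α β θ ϑ :=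
  RKHS.kerFun (bergmanSpace α β θ ϑ) w (1 : ℂ)

theorem inner_ker (w : bidisk) (f : bergmanSpace α β θ ϑ) :
    inner ℂ (ker α β θ ϑ w) f = rep f w := by
  rw [ker, RKHS.kerFun_inner, coe_eq_rep]
  simp

theorem kernel_eq_rep_ker (z w : bidisk) :
    RKHS.kernel (bergmanSpace α β θ ϑ) z w 1 = rep (ker α β θ ϑ w) z := by
  rw [← RKHS.kerFun_apply]
  rfl

end Space

/-! ### Reproducing kernels at diagonal points -/

/-- The reproducing kernel of `bergmanSpace α β θ ϑ` at the point `(ξ, ξ)`, without the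
normalizing constant. -/
def diagKer (α β θ ϑ : ℝ) (ξ : ℂ) (z : ℂ × ℂ) : ℂ :=
  szego (α + θ + ϑ + 2) ξ z.1 * szego (β + θ + ϑ + 2) ξ z.2

/-- By `szego_mob`, the product of `szego` at `z` and at `mob ξ z` is a positive constant. This
supplies the relation `J * conj (k ∘ Φ) = k` that `integral_mul_conj_of_map` requires. -/
theorem mul_conj_szego_mob {c : ℝ} {ξ z : ℂ} (hξ : ξ ∈ disk) (hz : z ∈ disk) :
    ((defect ξ ^ c * ‖1 - conj ξ * z‖ ^ (-(2 * c)) : ℝ) : ℂ) * conj (szego c ξ (mob ξ z)) =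
      szego c ξ z := by
  have h0 := szego_ne_zero (c := c) hξ hz
  have h1 := congrArg conj (szego_mob (c := c) hξ hz)
  rw [map_mul, Complex.conj_ofReal] at h1
  have h2 : ((‖1 - conj ξ * z‖ ^ (-(2 * c)) : ℝ) : ℂ) = szego c ξ z * conj (szego c ξ z) := by
    rw [Complex.mul_conj', norm_szego, ← Complex.ofReal_pow, ← Real.rpow_natCast,
      ← Real.rpow_mul (norm_nonneg _)]
    congr 2
    push_cast; ring
  have h3 : ((defect ξ ^ c : ℝ) : ℂ) * ((defect ξ ^ (-c) : ℝ) : ℂ) = 1 := by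
    rw [← Complex.ofReal_mul, ← Real.rpow_add (defect_pos hξ), add_neg_cancel, Real.rpow_zero,
      Complex.ofReal_one]
  rw [Complex.ofReal_mul, h2]
  linear_combination ((defect ξ ^ c : ℝ) : ℂ) * szego c ξ z * h1 + szego c ξ z * h3

theorem dens_mob {s : ℝ} {ξ z : ℂ} (hξ : ξ ∈ disk) (hz : z ∈ disk) :
    dens s (mob ξ z) =
      defect ξ ^ (s + 2) * ‖1 - conj ξ * z‖ ^ (-(2 * (s + 2))) * dens s z := by
  have h1 : 0 < ‖1 - conj ξ * z‖ := norm_pos_iff.2 (one_sub_ne_zero hξ (le_of_lt hz))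
  have hd := defect_pos hξ
  have hdz := defect_pos hz
  rw [dens, dens, defect_mob hξ hz, Real.div_rpow (by positivity) (by positivity),
    Real.mul_rpow hd.le hdz.le, ← Real.rpow_two, ← Real.rpow_mul h1.le, Real.rpow_neg h1.le]
  field_simp

theorem integral_mul_conj_szego {s : ℝ} (hs : -1 < s) {ξ : ℂ} (hξ : ξ ∈ disk) {f : ℂ → ℂ}
    (hf : DifferentiableOn ℂ f disk)
    (hi : Integrable (fun z => f z * conj (szego (s + 2) ξ z)) (dA s)) :
    ∫ z, f z * conj (szego (s + 2) ξ z) ∂dA s = f ξ := by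
  have := isProbabilityMeasure_dA hs
  have hd := defect_pos hξ
  have hJm : Measurable fun z : ℂ => defect ξ ^ (s + 2) * ‖1 - conj ξ * z‖ ^ (-(2 * (s + 2))) := by
    fun_prop
  have h := integral_mul_conj_of_map (fun c hc => measurePreserving_rotation_dA s hc)
    (by simpa only [disk_eq_ball] using dA_ae_mem s) (measurable_mob ξ) hJm
    (by
      conv_lhs => rw [dA_eq]
      conv_rhs => rw [dA_eq]
      refine map_withDensity_of_comp_eq (measurePreserving_mob hξ)
        (measurable_dens s).ennreal_ofReal hJm.ennreal_ofReal ?_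
      filter_upwards [hyp_ae_mem] with z hz
      rw [← ENNReal.ofReal_mul (by positivity), dens_mob hξ hz])
    (by simpa only [disk_eq_ball] using differentiableOn_mob hξ)
    (by rw [← disk_eq_ball]; exact fun z hz => mob_mem hξ hz) (k := szego (s + 2) ξ) (f := f)
    (fun z _ => by positivity)
    (by rw [← disk_eq_ball]; exact fun z hz => mul_conj_szego_mob hξ hz)
    (by simpa only [disk_eq_ball] using differentiableOn_szego _ hξ)
    (by simpa only [disk_eq_ball] using hf) hi
  rw [h]
  simp

theorem differentiableOn_diagKer (α β θ ϑ : ℝ) {ξ : ℂ} (hξ : ξ ∈ disk) :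
    DifferentiableOn ℂ (diagKer α β θ ϑ ξ) bidisk :=
  ((differentiableOn_szego _ hξ).comp differentiableOn_fst fun _ hz => hz.1).mul
    ((differentiableOn_szego _ hξ).comp differentiableOn_snd fun _ hz => hz.2)

/-- The diagonal automorphism takes the origin to `(ξ, ξ)`, and `diagKer` is the holomorphic square
root, up to a constant, of its multiplier; the mean value property at the origin does the rest. -/
theorem integral_mul_conj_diagKer {α β θ ϑ : ℝ} (h : Admissible α β θ ϑ) {ξ : ℂ} (hξ : ξ ∈ disk)
    {f : ℂ × ℂ → ℂ} (hf : DifferentiableOn ℂ f bidisk)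
    (hi : Integrable (fun z => f z * conj (diagKer α β θ ϑ ξ z)) (bidiskMeasure α β θ ϑ)) :
    ∫ z, f z * conj (diagKer α β θ ϑ ξ z) ∂bidiskMeasure α β θ ϑ =
      (bidiskMeasure α β θ ϑ).real univ * f (ξ, ξ) := by
  have := isFiniteMeasure_bidiskMeasure h
  have hd := defect_pos hξ
  set a := α + θ + ϑ + 2 with ha
  set b := β + θ + ϑ + 2 with hb
  have hJm : Measurable fun z : ℂ × ℂ => (defect ξ ^ a * ‖1 - conj ξ * z.1‖ ^ (-(2 * a))) *
      (defect ξ ^ b * ‖1 - conj ξ * z.2‖ ^ (-(2 * b))) := by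
    fun_prop
  have hm : MapsTo (Prod.map (mob ξ) (mob ξ)) bidisk bidisk :=
    fun z hz => ⟨mob_mem hξ hz.1, mob_mem hξ hz.2⟩
  have h := integral_mul_conj_of_map
    (fun c hc => measurePreserving_rotation_bidisk θ ϑ h.alpha h.beta hc)
    (by simpa only [bidisk_eq_ball] using bidiskMeasure_ae_mem α β θ ϑ)
    ((measurable_mob ξ).prodMap (measurable_mob ξ)) hJm
    (by
      rw [bidiskMeasure_eq θ ϑ h.alpha h.beta]
      refine map_withDensity_of_comp_eq ((measurePreserving_mob hξ).prod (measurePreserving_mob hξ))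
        (measurable_bidens α β θ ϑ).ennreal_ofReal hJm.ennreal_ofReal ?_
      filter_upwards [hyp_prod_ae_mem] with z hz
      rw [← ENNReal.ofReal_mul (by positivity)]
      congr 1
      have e := bidens_mob (α := α) (β := β) (θ := θ) (ϑ := ϑ) hξ hz.1 hz.2
      change bidens α β θ ϑ (mob ξ z.1, mob ξ z.2) = _
      rw [e]
      have : defect ξ ^ (α + β + 2 * θ + 2 * ϑ + 4) = defect ξ ^ a * defect ξ ^ b := by
        rw [← Real.rpow_add hd]; congr 1; rw [ha, hb]; ring
      rw [this]
      ring)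
    (by
      rw [← bidisk_eq_ball]
      exact ((differentiableOn_mob hξ).comp differentiableOn_fst fun _ hz => hz.1).prodMk
        ((differentiableOn_mob hξ).comp differentiableOn_snd fun _ hz => hz.2))
    (by rw [← bidisk_eq_ball]; exact hm) (k := diagKer α β θ ϑ ξ) (f := f)
    (fun z _ => by positivity)
    (by
      rw [← bidisk_eq_ball]
      intro z hz
      have e1 := mul_conj_szego_mob (c := a) hξ hz.1
      have e2 := mul_conj_szego_mob (c := b) hξ hz.2
      simp only [diagKer, Prod.map_fst, Prod.map_snd, map_mul]
      rw [← ha, ← hb, Complex.ofReal_mul, ← e1, ← e2]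
      ring)
    (by simpa only [bidisk_eq_ball] using differentiableOn_diagKer α β θ ϑ hξ)
    (by simpa only [bidisk_eq_ball] using hf) hi
  have e0 : Prod.map (mob ξ) (mob ξ) 0 = (ξ, ξ) := Prod.ext (mob_zero ξ) (mob_zero ξ)
  rw [h, e0]
  simp [diagKer]

theorem exists_bound_diagKer (α β θ ϑ : ℝ) {ξ : ℂ} (hξ : ξ ∈ disk) :
    ∃ C, ∀ z ∈ bidisk, ‖diagKer α β θ ϑ ξ z‖ ≤ C := by
  refine ⟨((1 - ‖ξ‖) ^ (-(α + θ + ϑ + 2)) + 2 ^ (-(α + θ + ϑ + 2))) *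
    ((1 - ‖ξ‖) ^ (-(β + θ + ϑ + 2)) + 2 ^ (-(β + θ + ϑ + 2))), fun z hz => ?_⟩
  rw [diagKer, norm_mul]
  have h1 := norm_szego_le (c := α + θ + ϑ + 2) hξ (le_of_lt hz.1)
  have h2 := norm_szego_le (c := β + θ + ϑ + 2) hξ (le_of_lt hz.2)
  exact mul_le_mul h1 h2 (norm_nonneg _) ((norm_nonneg _).trans h1)

/-- The two exponents add up to `s + 2`, the exponent of the reproducing kernel for `dA s` with `s =
diagExp α β θ ϑ`; diagonal restriction is isometric up to scale for this reason. -/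
theorem diagKer_diag {α β θ ϑ : ℝ} {ξ z : ℂ} (hξ : ξ ∈ disk) (hz : z ∈ disk) :
    diagKer α β θ ϑ ξ (z, z) = szego (α + β + 2 * θ + 2 * ϑ + 2 + 2) ξ z := by
  rw [diagKer, ← szego_add hξ hz]
  congr 1
  ring

/-- The function `ξ ↦ conj (diagKer ξ z)`, which is holomorphic in `ξ`. -/
def codiagKer (α β θ ϑ : ℝ) (z : ℂ × ℂ) (ξ : ℂ) : ℂ :=
  szego (α + θ + ϑ + 2) z.1 ξ * szego (β + θ + ϑ + 2) z.2 ξ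

theorem conj_diagKer {α β θ ϑ : ℝ} {ξ : ℂ} {z : ℂ × ℂ} (hξ : ξ ∈ disk) (hz : z ∈ bidisk) :
    conj (diagKer α β θ ϑ ξ z) = codiagKer α β θ ϑ z ξ := by
  rw [diagKer, codiagKer, map_mul, szego_conj_symm hξ hz.1, szego_conj_symm hξ hz.2]

theorem differentiableOn_codiagKer (α β θ ϑ : ℝ) {z : ℂ × ℂ} (hz : z ∈ bidisk) :
    DifferentiableOn ℂ (codiagKer α β θ ϑ z) disk :=
  (differentiableOn_szego _ hz.1).mul (differentiableOn_szego _ hz.2)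

theorem exists_bound_codiagKer (α β θ ϑ : ℝ) {z : ℂ × ℂ} (hz : z ∈ bidisk) :
    ∃ C, ∀ ξ ∈ disk, ‖codiagKer α β θ ϑ z ξ‖ ≤ C := by
  refine ⟨((1 - ‖z.1‖) ^ (-(α + θ + ϑ + 2)) + 2 ^ (-(α + θ + ϑ + 2))) *
    ((1 - ‖z.2‖) ^ (-(β + θ + ϑ + 2)) + 2 ^ (-(β + θ + ϑ + 2))), fun ξ hξ => ?_⟩
  rw [codiagKer, norm_mul]
  have h1 := norm_szego_le (c := α + θ + ϑ + 2) hz.1 (le_of_lt hξ)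
  have h2 := norm_szego_le (c := β + θ + ϑ + 2) hz.2 (le_of_lt hξ)
  exact mul_le_mul h1 h2 (norm_nonneg _) ((norm_nonneg _).trans h1)

theorem aestronglyMeasurable_dA {f : ℂ → ℂ} (hf : ContinuousOn f disk) (s : ℝ) :
    AEStronglyMeasurable f (dA s) :=
  (hf.aestronglyMeasurable isOpen_disk.measurableSet).mono_ac (withDensity_absolutelyContinuous _ _)

theorem aestronglyMeasurable_bidiskMeasure {α β : ℝ} (θ ϑ : ℝ) (hα : -1 < α) (hβ : -1 < β)
    {f : ℂ × ℂ → ℂ} (hf : ContinuousOn f bidisk) :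
    AEStronglyMeasurable f (bidiskMeasure α β θ ϑ) :=
  (hf.aestronglyMeasurable isOpen_bidisk.measurableSet).mono_ac
    (bidiskMeasure_absolutelyContinuous α β θ ϑ hα hβ)

theorem memLp_dA_of_bound {f : ℂ → ℂ} {s C : ℝ} (hs : -1 < s) (p : ℝ≥0∞)
    (hf : ContinuousOn f disk) (hC : ∀ ξ ∈ disk, ‖f ξ‖ ≤ C) : MemLp f p (dA s) := by
  have := isProbabilityMeasure_dA hs
  refine MemLp.of_bound (aestronglyMeasurable_dA hf s) C ?_
  filter_upwards [dA_ae_mem s] with ξ hξ using hC ξ hξ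

/-- The integrand of the kernel expansion factors into diagonal kernels. -/
theorem kernelIntegrand_eq {α β θ ϑ : ℝ} (N : ℕ) {z w : ℂ × ℂ} {ξ : ℂ} (hz : z ∈ bidisk)
    (hw : w ∈ bidisk) (hξ : ξ ∈ disk) :
    kernelIntegrand α β θ ϑ N z w ξ =
      conj (codiagKer α β (θ + N) ϑ z ξ) * codiagKer α β (θ + N) ϑ w ξ := by
  have key : ∀ {c : ℝ} {x y : ℂ}, x ∈ disk → y ∈ disk →
      (((1 - conj ξ * x) * (1 - conj y * ξ)) ^ (c : ℂ))⁻¹ =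
        conj (szego c x ξ) * szego c y ξ := by
    intro c x y hx hy
    rw [szego_conj_symm hx hξ, szego, szego,
      mul_cpow_of_re_pos (re_one_sub_pos hξ (le_of_lt hx)) (re_one_sub_pos hy (le_of_lt hξ)),
      mul_inv, Complex.ofReal_neg, Complex.cpow_neg, Complex.cpow_neg]
  rw [kernelIntegrand, one_div, mul_inv, key hz.1 hw.1, key hz.2 hw.2, codiagKer, codiagKer,
    map_mul, show α + θ + ϑ + (N : ℝ) + 2 = α + (θ + N) + ϑ + 2 by ring,
    show β + θ + ϑ + (N : ℝ) + 2 = β + (θ + N) + ϑ + 2 by ring]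
  ring

theorem memLp_kernelIntegrand {α β θ ϑ s : ℝ} (hs : -1 < s) (N : ℕ) {z w : ℂ × ℂ}
    (hz : z ∈ bidisk) (hw : w ∈ bidisk) (p : ℝ≥0∞) :
    MemLp (kernelIntegrand α β θ ϑ N z w) p (dA s) := by
  have hae : (fun ξ => conj (codiagKer α β (θ + N) ϑ z ξ) * codiagKer α β (θ + N) ϑ w ξ) =ᵐ[dA s]
      kernelIntegrand α β θ ϑ N z w := by
    filter_upwards [dA_ae_mem s] with ξ hξ using (kernelIntegrand_eq N hz hw hξ).symm
  obtain ⟨C₁, h₁⟩ := exists_bound_codiagKer α β (θ + N) ϑ hz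
  obtain ⟨C₂, h₂⟩ := exists_bound_codiagKer α β (θ + N) ϑ hw
  refine MemLp.ae_eq hae (memLp_dA_of_bound (C := C₁ * C₂) hs p ?_ fun ξ hξ => ?_)
  · exact (Complex.continuous_conj.comp_continuousOn
      (differentiableOn_codiagKer _ _ _ _ hz).continuousOn).mul
      (differentiableOn_codiagKer _ _ _ _ hw).continuousOn
  · rw [norm_mul, RCLike.norm_conj]
    exact mul_le_mul (h₁ ξ hξ) (h₂ ξ hξ) (norm_nonneg _) ((norm_nonneg _).trans (h₁ ξ hξ))

/-! ### Restriction to the diagonal -/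

section Diagonal

/-- The exponent of the weight on the diagonal. -/
def diagExp (α β θ ϑ : ℝ) : ℝ := α + β + 2 * θ + 2 * ϑ + 2

theorem Admissible.diagExp_gt {α β θ ϑ : ℝ} (h : Admissible α β θ ϑ) :
    -1 < diagExp α β θ ϑ := by
  have := h.sum
  unfold diagExp
  linarith

variable {α β θ ϑ : ℝ}

/-- The restriction to the diagonal of the holomorphic representative. -/
def onDiag (f : bergmanSpace α β θ ϑ) (ξ : ℂ) : ℂ := rep f (ξ, ξ)

theorem diag_mem {ξ : ℂ} (hξ : ξ ∈ disk) : ((ξ, ξ) : ℂ × ℂ) ∈ bidisk := ⟨hξ, hξ⟩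

theorem differentiableOn_onDiag (f : bergmanSpace α β θ ϑ) :
    DifferentiableOn ℂ (onDiag f) disk :=
  (differentiableOn_rep f).comp (by fun_prop) fun _ hξ => diag_mem hξ

variable [ha : Fact (Admissible α β θ ϑ)]

instance : IsFiniteMeasure (bidiskMeasure α β θ ϑ) := isFiniteMeasure_bidiskMeasure ha.out

theorem memLp_diagKer (ξ : disk) : MemLp (diagKer α β θ ϑ ξ) 2 (bidiskMeasure α β θ ϑ) := by
  obtain ⟨C, hC⟩ := exists_bound_diagKer α β θ ϑ ξ.2
  refine MemLp.of_bound (aestronglyMeasurable_bidiskMeasure θ ϑ ha.out.alpha ha.out.beta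
    (differentiableOn_diagKer _ _ _ _ ξ.2).continuousOn) C ?_
  filter_upwards [bidiskMeasure_ae_mem α β θ ϑ] with z hz using hC z hz

/-- The function `diagKer ξ` as an element of the Bergman space. -/
def diagVec (α β θ ϑ : ℝ) [Fact (Admissible α β θ ϑ)] (ξ : disk) : bergmanSpace α β θ ϑ :=
  ofFun (diagKer α β θ ϑ ξ) (differentiableOn_diagKer α β θ ϑ ξ.2) (memLp_diagKer ξ)

theorem rep_diagVec (ξ : disk) : EqOn (rep (diagVec α β θ ϑ ξ)) (diagKer α β θ ϑ ξ) bidisk :=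
  rep_eqOn (differentiableOn_diagKer α β θ ϑ ξ.2) (ofFun_ae_eq _ _ _)

theorem onDiag_eq_inner (f : bergmanSpace α β θ ϑ) (ξ : disk) :
    onDiag f ξ = sigma α β θ ϑ * inner ℂ (diagVec α β θ ϑ ξ) f := by
  have hpos := bidiskMeasure_real_univ_pos ha.out
  have hae : (fun z => conj (rep (diagVec α β θ ϑ ξ) z) * rep f z) =ᵐ[bidiskMeasure α β θ ϑ]
      fun z => rep f z * conj (diagKer α β θ ϑ ξ z) := by
    filter_upwards [bidiskMeasure_ae_mem α β θ ϑ] with z hz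
    rw [rep_diagVec ξ hz, mul_comm]
  have hi : Integrable (fun z => rep f z * conj (diagKer α β θ ϑ ξ z))
      (bidiskMeasure α β θ ϑ) :=
    (memLp_rep f).integrable_mul (memLp_diagKer ξ).star
  rw [inner_eq_integral, integral_congr_ae hae,
    integral_mul_conj_diagKer ha.out ξ.2 (differentiableOn_rep f) hi, sigma_eq_inv,
    Complex.ofReal_inv, inv_mul_cancel_left₀ (by exact_mod_cast hpos.ne')]
  rfl

/-- The span of the kernels at diagonal points. -/
def diagSpan (α β θ ϑ : ℝ) [Fact (Admissible α β θ ϑ)] : Submodule ℂ (bergmanSpace α β θ ϑ) :=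
  Submodule.span ℂ (range (diagVec α β θ ϑ))

theorem diagVec_mem (ξ : disk) : diagVec α β θ ϑ ξ ∈ diagSpan α β θ ϑ :=
  Submodule.subset_span ⟨ξ, rfl⟩

theorem onDiag_add (f g : bergmanSpace α β θ ϑ) {ξ : ℂ} (hξ : ξ ∈ disk) :
    onDiag (f + g) ξ = onDiag f ξ + onDiag g ξ := rep_add f g (diag_mem hξ)

theorem onDiag_sub (f g : bergmanSpace α β θ ϑ) {ξ : ℂ} (hξ : ξ ∈ disk) :
    onDiag (f - g) ξ = onDiag f ξ - onDiag g ξ := rep_sub f g (diag_mem hξ)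

theorem onDiag_smul (c : ℂ) (f : bergmanSpace α β θ ϑ) {ξ : ℂ} (hξ : ξ ∈ disk) :
    onDiag (c • f) ξ = c * onDiag f ξ := rep_smul c f (diag_mem hξ)

theorem onDiag_diagVec (η : disk) {ξ : ℂ} (hξ : ξ ∈ disk) :
    onDiag (diagVec α β θ ϑ η) ξ = szego (diagExp α β θ ϑ + 2) η ξ := by
  rw [onDiag, rep_diagVec η (diag_mem hξ), diagKer_diag η.2 hξ, diagExp]

theorem exists_bound_onDiag {f : bergmanSpace α β θ ϑ} (hf : f ∈ diagSpan α β θ ϑ) :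
    ∃ C, ∀ ξ ∈ disk, ‖onDiag f ξ‖ ≤ C := by
  induction hf using Submodule.span_induction with
  | mem x hx =>
    obtain ⟨η, rfl⟩ := hx
    obtain ⟨C, hC⟩ := exists_bound_diagKer α β θ ϑ η.2
    refine ⟨C, fun ξ hξ => ?_⟩
    rw [onDiag, rep_diagVec η (diag_mem hξ)]
    exact hC _ (diag_mem hξ)
  | zero =>
    refine ⟨0, fun ξ hξ => ?_⟩
    have := onDiag_smul 0 (0 : bergmanSpace α β θ ϑ) hξ
    rw [zero_smul, zero_mul] at this
    simp [this]
  | add x y _ _ hx hy =>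
    obtain ⟨C, hC⟩ := hx
    obtain ⟨D, hD⟩ := hy
    refine ⟨C + D, fun ξ hξ => ?_⟩
    rw [onDiag_add x y hξ]
    exact (norm_add_le _ _).trans (add_le_add (hC ξ hξ) (hD ξ hξ))
  | smul c x _ hx =>
    obtain ⟨C, hC⟩ := hx
    refine ⟨‖c‖ * C, fun ξ hξ => ?_⟩
    rw [onDiag_smul c x hξ, norm_mul]
    exact mul_le_mul_of_nonneg_left (hC ξ hξ) (norm_nonneg _)

theorem memLp_onDiag_of_mem_span {f : bergmanSpace α β θ ϑ} (hf : f ∈ diagSpan α β θ ϑ) :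
    MemLp (onDiag f) 2 (dA (diagExp α β θ ϑ)) := by
  obtain ⟨C, hC⟩ := exists_bound_onDiag hf
  exact memLp_dA_of_bound ha.out.diagExp_gt 2 (differentiableOn_onDiag f).continuousOn hC

/-- For `g` a diagonal kernel both sides are `onDiag f η`: one by the reproducing property on the
disk, the other by that on the bidisk. The general case follows by conjugate linearity in `g`. -/
theorem integral_onDiag_mul_conj {f g : bergmanSpace α β θ ϑ} (hf : f ∈ diagSpan α β θ ϑ)
    (hg : g ∈ diagSpan α β θ ϑ) :
    ∫ ξ, onDiag f ξ * conj (onDiag g ξ) ∂dA (diagExp α β θ ϑ) =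
      sigma α β θ ϑ * inner ℂ g f := by
  have hmf := memLp_onDiag_of_mem_span hf
  have hint : ∀ {g : bergmanSpace α β θ ϑ}, g ∈ diagSpan α β θ ϑ →
      Integrable (fun ξ => onDiag f ξ * conj (onDiag g ξ)) (dA (diagExp α β θ ϑ)) := fun hg =>
    hmf.integrable_mul (memLp_onDiag_of_mem_span hg).star
  induction hg using Submodule.span_induction with
  | mem x hx =>
    obtain ⟨η, rfl⟩ := hx
    have hae : (fun ξ => onDiag f ξ * conj (onDiag (diagVec α β θ ϑ η) ξ))
        =ᵐ[dA (diagExp α β θ ϑ)]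
        fun ξ => onDiag f ξ * conj (szego (diagExp α β θ ϑ + 2) η ξ) := by
      filter_upwards [dA_ae_mem _] with ξ hξ
      rw [onDiag_diagVec η hξ]
    rw [integral_congr_ae hae, integral_mul_conj_szego ha.out.diagExp_gt η.2
      (differentiableOn_onDiag f) ((hint (diagVec_mem η)).congr hae), onDiag_eq_inner]
  | zero =>
    have hae : (fun ξ => onDiag f ξ * conj (onDiag (0 : bergmanSpace α β θ ϑ) ξ))
        =ᵐ[dA (diagExp α β θ ϑ)] fun _ => 0 := by
      filter_upwards [dA_ae_mem _] with ξ hξ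
      have := onDiag_smul 0 (0 : bergmanSpace α β θ ϑ) hξ
      rw [zero_smul, zero_mul] at this
      simp [this]
    rw [integral_congr_ae hae]
    simp
  | add x y hx hy hx' hy' =>
    have hae : (fun ξ => onDiag f ξ * conj (onDiag (x + y) ξ)) =ᵐ[dA (diagExp α β θ ϑ)]
        fun ξ => onDiag f ξ * conj (onDiag x ξ) + onDiag f ξ * conj (onDiag y ξ) := by
      filter_upwards [dA_ae_mem _] with ξ hξ
      rw [onDiag_add x y hξ, map_add, mul_add]
    rw [integral_congr_ae hae, integral_add (hint hx) (hint hy), hx', hy', inner_add_left,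
      mul_add]
  | smul c x hx hx' =>
    have hae : (fun ξ => onDiag f ξ * conj (onDiag (c • x) ξ)) =ᵐ[dA (diagExp α β θ ϑ)]
        fun ξ => conj c * (onDiag f ξ * conj (onDiag x ξ)) := by
      filter_upwards [dA_ae_mem _] with ξ hξ
      rw [onDiag_smul c x hξ, map_mul]
      ring
    rw [integral_congr_ae hae, integral_const_mul, hx', inner_smul_left]
    ring

theorem eLpNorm_onDiag_of_mem_span {f : bergmanSpace α β θ ϑ} (hf : f ∈ diagSpan α β θ ϑ) :
    eLpNorm (onDiag f) 2 (dA (diagExp α β θ ϑ)) = ENNReal.ofReal (√(sigma α β θ ϑ) * ‖f‖) := by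
  have hm := memLp_onDiag_of_mem_span hf
  have hσ := sigma_pos ha.out
  have h1 : ‖hm.toLp‖ ^ 2 = (√(sigma α β θ ϑ) * ‖f‖) ^ 2 := by
    have e1 : inner ℂ hm.toLp hm.toLp = ((‖hm.toLp‖ ^ 2 : ℝ) : ℂ) := by
      rw [inner_self_eq_norm_sq_to_K]; push_cast; rfl
    have e2 : inner ℂ f f = ((‖f‖ ^ 2 : ℝ) : ℂ) := by
      have := inner_self_eq_norm_sq_to_K (𝕜 := ℂ) f
      push_cast; exact this
    have e3 := integral_onDiag_mul_conj hf hf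
    rw [e2, ← Complex.ofReal_mul] at e3
    have e4 : inner ℂ hm.toLp hm.toLp =
        ∫ ξ, onDiag f ξ * conj (onDiag f ξ) ∂dA (diagExp α β θ ϑ) := by
      rw [L2.inner_def]
      refine integral_congr_ae ?_
      filter_upwards [hm.coeFn_toLp] with ξ hξ
      rw [hξ, RCLike.inner_apply]
    rw [← e4, e1] at e3
    rw [mul_pow, Real.sq_sqrt hσ.le]
    exact_mod_cast e3
  have h2 : ‖hm.toLp‖ = √(sigma α β θ ϑ) * ‖f‖ :=
    (pow_left_inj₀ (norm_nonneg _) (by positivity) two_ne_zero).1 h1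
  rw [← h2, Lp.norm_toLp, ENNReal.ofReal_toReal hm.eLpNorm_ne_top]

/-- The closed span of the kernels at diagonal points. -/
def diagSpace (α β θ ϑ : ℝ) [Fact (Admissible α β θ ϑ)] : Submodule ℂ (bergmanSpace α β θ ϑ) :=
  (diagSpan α β θ ϑ).topologicalClosure

theorem exists_seq_of_mem_diagSpace {f : bergmanSpace α β θ ϑ} (hf : f ∈ diagSpace α β θ ϑ) :
    ∃ F : ℕ → bergmanSpace α β θ ϑ, (∀ n, F n ∈ diagSpan α β θ ϑ) ∧ Tendsto F atTop (𝓝 f) :=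
  mem_closure_iff_seq_limit.1 hf

theorem tendsto_rep {F : ℕ → bergmanSpace α β θ ϑ} {f : bergmanSpace α β θ ϑ}
    (h : Tendsto F atTop (𝓝 f)) {z : ℂ × ℂ} (hz : z ∈ bidisk) :
    Tendsto (fun n => rep (F n) z) atTop (𝓝 (rep f z)) :=
  ((evalCLM α β θ ϑ ⟨z, hz⟩).continuous.tendsto f).comp h

/-- Fatou's lemma carries the bound from the span to its closure, since norm convergence implies
pointwise convergence of the diagonal values. -/
theorem eLpNorm_onDiag_le {f : bergmanSpace α β θ ϑ} (hf : f ∈ diagSpace α β θ ϑ) :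
    eLpNorm (onDiag f) 2 (dA (diagExp α β θ ϑ)) ≤ ENNReal.ofReal (√(sigma α β θ ϑ) * ‖f‖) := by
  obtain ⟨F, hF, hlim⟩ := exists_seq_of_mem_diagSpace hf
  have h1 := Lp.eLpNorm_lim_le_liminf_eLpNorm (p := 2) (μ := dA (diagExp α β θ ϑ))
    (f := fun n => onDiag (F n))
    (fun n => aestronglyMeasurable_dA (differentiableOn_onDiag (F n)).continuousOn _) (onDiag f)
    (by
      filter_upwards [dA_ae_mem _] with ξ hξ using tendsto_rep hlim (diag_mem hξ))
  simp only [fun n => eLpNorm_onDiag_of_mem_span (hF n)] at h1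
  have h2 : Tendsto (fun n => ENNReal.ofReal (√(sigma α β θ ϑ) * ‖F n‖)) atTop
      (𝓝 (ENNReal.ofReal (√(sigma α β θ ϑ) * ‖f‖))) :=
    ENNReal.tendsto_ofReal (hlim.norm.const_mul _)
  rwa [h2.liminf_eq] at h1

theorem memLp_onDiag {f : bergmanSpace α β θ ϑ} (hf : f ∈ diagSpace α β θ ϑ) :
    MemLp (onDiag f) 2 (dA (diagExp α β θ ϑ)) :=
  ⟨aestronglyMeasurable_dA (differentiableOn_onDiag f).continuousOn _,
    (eLpNorm_onDiag_le hf).trans_lt ENNReal.ofReal_lt_top⟩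

theorem memLp_codiagKer {z : ℂ × ℂ} (hz : z ∈ bidisk) (p : ℝ≥0∞) :
    MemLp (codiagKer α β θ ϑ z) p (dA (diagExp α β θ ϑ)) := by
  obtain ⟨C, hC⟩ := exists_bound_codiagKer α β θ ϑ hz
  exact memLp_dA_of_bound ha.out.diagExp_gt p (differentiableOn_codiagKer _ _ _ _ hz).continuousOn hC

theorem integrable_onDiag_mul {f : bergmanSpace α β θ ϑ} (hf : f ∈ diagSpace α β θ ϑ) {z : ℂ × ℂ}
    (hz : z ∈ bidisk) :
    Integrable (fun ξ => onDiag f ξ * conj (codiagKer α β θ ϑ z ξ)) (dA (diagExp α β θ ϑ)) :=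
  (memLp_onDiag hf).integrable_mul (memLp_codiagKer hz 2).star

theorem norm_integral_onDiag_le {z : ℂ × ℂ} (hz : z ∈ bidisk) :
    ∃ C : ℝ, ∀ f ∈ diagSpace α β θ ϑ,
      ‖∫ ξ, onDiag f ξ * conj (codiagKer α β θ ϑ z ξ) ∂dA (diagExp α β θ ϑ)‖ ≤ C * ‖f‖ := by
  have hk := memLp_codiagKer (α := α) (β := β) (θ := θ) (ϑ := ϑ) hz 2
  refine ⟨‖hk.toLp‖ * √(sigma α β θ ϑ), fun f hf => ?_⟩
  have hm := memLp_onDiag hf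
  have e : inner ℂ hk.toLp hm.toLp =
      ∫ ξ, onDiag f ξ * conj (codiagKer α β θ ϑ z ξ) ∂dA (diagExp α β θ ϑ) := by
    rw [L2.inner_def]
    refine integral_congr_ae ?_
    filter_upwards [hm.coeFn_toLp, hk.coeFn_toLp] with ξ h1 h2
    rw [h1, h2, RCLike.inner_apply]
  rw [← e]
  refine (norm_inner_le_norm _ _).trans ?_
  rw [mul_assoc]
  refine mul_le_mul_of_nonneg_left ?_ (norm_nonneg _)
  rw [Lp.norm_toLp]
  exact ENNReal.toReal_le_of_le_ofReal (by positivity) (eLpNorm_onDiag_le hf)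

theorem diagSpan_le : diagSpan α β θ ϑ ≤ diagSpace α β θ ϑ := Submodule.le_topologicalClosure _

/-- For a diagonal kernel this is the conjugate of the disk reproducing formula applied to
`codiagKer z`, which is holomorphic in `ξ`. -/
theorem rep_eq_integral_of_mem_span {f : bergmanSpace α β θ ϑ} (hf : f ∈ diagSpan α β θ ϑ)
    {z : ℂ × ℂ} (hz : z ∈ bidisk) :
    rep f z = ∫ ξ, onDiag f ξ * conj (codiagKer α β θ ϑ z ξ) ∂dA (diagExp α β θ ϑ) := by
  have hint : ∀ {f : bergmanSpace α β θ ϑ}, f ∈ diagSpan α β θ ϑ → Integrable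
      (fun ξ => onDiag f ξ * conj (codiagKer α β θ ϑ z ξ)) (dA (diagExp α β θ ϑ)) := fun hf =>
    integrable_onDiag_mul (diagSpan_le hf) hz
  induction hf using Submodule.span_induction with
  | mem x hx =>
    obtain ⟨η, rfl⟩ := hx
    have hae : (fun ξ => onDiag (diagVec α β θ ϑ η) ξ * conj (codiagKer α β θ ϑ z ξ))
        =ᵐ[dA (diagExp α β θ ϑ)]
        fun ξ => conj (codiagKer α β θ ϑ z ξ * conj (szego (diagExp α β θ ϑ + 2) η ξ)) := by
      filter_upwards [dA_ae_mem _] with ξ hξ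
      rw [onDiag_diagVec η hξ, map_mul, Complex.conj_conj, mul_comm]
    have hi : Integrable
        (fun ξ => codiagKer α β θ ϑ z ξ * conj (szego (diagExp α β θ ϑ + 2) η ξ))
        (dA (diagExp α β θ ϑ)) := by
      have := Complex.conjCLE.toContinuousLinearMap.integrable_comp
        ((hint (diagVec_mem η)).congr hae)
      simpa using this
    rw [integral_congr_ae hae, integral_conj, integral_mul_conj_szego ha.out.diagExp_gt η.2
      (differentiableOn_codiagKer _ _ _ _ hz) hi, rep_diagVec η hz, ← conj_diagKer η.2 hz,
      Complex.conj_conj]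
  | zero =>
    have h0 : ∀ y ∈ bidisk, rep (0 : bergmanSpace α β θ ϑ) y = 0 := fun y hy => by
      have := rep_smul 0 (0 : bergmanSpace α β θ ϑ) hy
      rw [zero_smul] at this
      simpa using this
    have hae : (fun ξ => onDiag (0 : bergmanSpace α β θ ϑ) ξ * conj (codiagKer α β θ ϑ z ξ))
        =ᵐ[dA (diagExp α β θ ϑ)] fun _ => 0 := by
      filter_upwards [dA_ae_mem _] with ξ hξ
      rw [onDiag, h0 _ (diag_mem hξ), zero_mul]
    rw [integral_congr_ae hae, h0 z hz]
    simp
  | add x y hx hy hx' hy' =>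
    have hae : (fun ξ => onDiag (x + y) ξ * conj (codiagKer α β θ ϑ z ξ))
        =ᵐ[dA (diagExp α β θ ϑ)] fun ξ => onDiag x ξ * conj (codiagKer α β θ ϑ z ξ) +
          onDiag y ξ * conj (codiagKer α β θ ϑ z ξ) := by
      filter_upwards [dA_ae_mem _] with ξ hξ
      rw [onDiag_add x y hξ, add_mul]
    rw [integral_congr_ae hae, integral_add (hint hx) (hint hy), ← hx', ← hy', rep_add x y hz]
    rfl
  | smul c x hx hx' =>
    have hae : (fun ξ => onDiag (c • x) ξ * conj (codiagKer α β θ ϑ z ξ))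
        =ᵐ[dA (diagExp α β θ ϑ)] fun ξ => c * (onDiag x ξ * conj (codiagKer α β θ ϑ z ξ)) := by
      filter_upwards [dA_ae_mem _] with ξ hξ
      rw [onDiag_smul c x hξ, mul_assoc]
    rw [integral_congr_ae hae, integral_const_mul, ← hx', rep_smul c x hz]
    rfl

theorem rep_eq_integral {f : bergmanSpace α β θ ϑ} (hf : f ∈ diagSpace α β θ ϑ)
    {z : ℂ × ℂ} (hz : z ∈ bidisk) :
    rep f z = ∫ ξ, onDiag f ξ * conj (codiagKer α β θ ϑ z ξ) ∂dA (diagExp α β θ ϑ) := by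
  obtain ⟨F, hF, hlim⟩ := exists_seq_of_mem_diagSpace hf
  obtain ⟨C, hC⟩ := norm_integral_onDiag_le (α := α) (β := β) (θ := θ) (ϑ := ϑ) hz
  refine tendsto_nhds_unique (tendsto_rep hlim hz) ?_
  rw [tendsto_iff_norm_sub_tendsto_zero]
  have h0 : Tendsto (fun n => C * ‖F n - f‖) atTop (𝓝 0) := by
    simpa using (tendsto_iff_norm_sub_tendsto_zero.1 hlim).const_mul C
  refine squeeze_zero (fun _ => norm_nonneg _) (fun n => ?_) h0
  have hFn := diagSpan_le (hF n)
  refine le_trans (le_of_eq ?_) (hC (F n - f) (Submodule.sub_mem _ hFn hf))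
  rw [rep_eq_integral_of_mem_span (hF n) hz, ← integral_sub (integrable_onDiag_mul hFn hz)
    (integrable_onDiag_mul hf hz)]
  congr 1
  refine integral_congr_ae ?_
  filter_upwards [dA_ae_mem _] with ξ hξ
  rw [onDiag_sub _ _ hξ, sub_mul]

/-- The zeroth term of the kernel expansion. -/
def diagTerm (α β θ ϑ : ℝ) (z w : ℂ × ℂ) : ℂ :=
  sigma α β θ ϑ * ∫ ξ, conj (codiagKer α β θ ϑ z ξ) * codiagKer α β θ ϑ w ξ
    ∂dA (diagExp α β θ ϑ)

instance : (diagSpace α β θ ϑ).HasOrthogonalProjection := by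
  have : CompleteSpace (diagSpace α β θ ϑ) :=
    (Submodule.isClosed_topologicalClosure (diagSpan α β θ ϑ)).completeSpace_coe
  infer_instance

/-- The projection of the reproducing kernel to the closed span of the kernels at diagonal
points. -/
theorem rep_starProjection_ker (w : bidisk) {z : ℂ × ℂ} (hz : z ∈ bidisk) :
    rep ((diagSpace α β θ ϑ).starProjection (ker α β θ ϑ w)) z = diagTerm α β θ ϑ z w := by
  set q := (diagSpace α β θ ϑ).starProjection (ker α β θ ϑ w) with hq
  have hqm : q ∈ diagSpace α β θ ϑ := Submodule.starProjection_apply_mem _ _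
  -- The projection fixes every diagonal kernel, so pairing with one does not distinguish `q` from
  -- the full kernel at `w`.
  have hqd : ∀ ξ : disk, onDiag q ξ = sigma α β θ ϑ * codiagKer α β θ ϑ w ξ := by
    intro ξ
    have hmem : diagVec α β θ ϑ ξ ∈ diagSpace α β θ ϑ := diagSpan_le (diagVec_mem ξ)
    rw [onDiag_eq_inner, hq, ← Submodule.inner_starProjection_left_eq_right,
      Submodule.starProjection_eq_self_iff.2 hmem, ← inner_conj_symm, inner_ker,
      rep_diagVec ξ w.2, conj_diagKer ξ.2 w.2]
  rw [rep_eq_integral hqm hz, diagTerm, ← integral_const_mul]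
  refine integral_congr_ae ?_
  filter_upwards [dA_ae_mem _] with ξ hξ
  rw [hqd ⟨ξ, hξ⟩]
  ring

theorem onDiag_eq_zero_of_mem_orthogonal {f : bergmanSpace α β θ ϑ}
    (hf : f ∈ (diagSpace α β θ ϑ)ᗮ) {ξ : ℂ} (hξ : ξ ∈ disk) : onDiag f ξ = 0 := by
  rw [onDiag_eq_inner f ⟨ξ, hξ⟩, hf _ (diagSpan_le (diagVec_mem ⟨ξ, hξ⟩)), mul_zero]

theorem mem_orthogonal_of_onDiag_eq_zero {f : bergmanSpace α β θ ϑ}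
    (hf : ∀ ξ ∈ disk, onDiag f ξ = 0) : f ∈ (diagSpace α β θ ϑ)ᗮ := by
  have hσ : (sigma α β θ ϑ : ℂ) ≠ 0 := by exact_mod_cast (sigma_pos ha.out).ne'
  rw [diagSpace, Submodule.orthogonal_closure, diagSpan, Submodule.mem_orthogonal]
  intro u hu
  induction hu using Submodule.span_induction with
  | mem x hx =>
    obtain ⟨η, rfl⟩ := hx
    have := hf η η.2
    rw [onDiag_eq_inner] at this
    exact (mul_eq_zero.1 this).resolve_left hσ
  | zero => exact inner_zero_left _
  | add x y _ _ hx hy => rw [inner_add_left, hx, hy, add_zero]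
  | smul c x _ hx => rw [inner_smul_left, hx, mul_zero]

end Diagonal

/-! ### Multiplication by powers of `z₁ - z₂` -/

theorem weight_add_nat {θ : ℝ} (hθ : -1 < θ) (ϑ : ℝ) (N : ℕ) (z : ℂ × ℂ) :
    weight (θ + N) ϑ z = weight θ ϑ z * ‖(z.1 - z.2) ^ N‖ ^ 2 := by
  -- For `N ≥ 1` one has `θ + N > 0`, so both sides vanish on the diagonal; `N = 0` needs no such
  -- comparison.
  rcases Nat.eq_zero_or_pos N with rfl | hN
  · simp
  have hN1 : (1 : ℝ) ≤ N := by exact_mod_cast hN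
  unfold weight
  rw [mul_assoc]
  congr 1
  rw [norm_pow, ← pow_mul]
  rcases (norm_nonneg (z.1 - z.2)).eq_or_lt with h0 | h0
  · rw [← h0, Real.zero_rpow (by linarith), zero_pow (by omega), mul_zero]
  · rw [← Real.rpow_natCast, ← Real.rpow_add h0]
    congr 1
    push_cast; ring

theorem bidiskMeasure_add_nat (α β : ℝ) {θ : ℝ} (hθ : -1 < θ) (ϑ : ℝ) (N : ℕ) :
    bidiskMeasure α β (θ + N) ϑ = (bidiskMeasure α β θ ϑ).withDensity fun z =>
      ENNReal.ofReal (‖(z.1 - z.2) ^ N‖ ^ 2) := by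
  have hm : Measurable fun z : ℂ × ℂ => ENNReal.ofReal (‖(z.1 - z.2) ^ N‖ ^ 2) := by fun_prop
  rw [bidiskMeasure, bidiskMeasure, ← withDensity_mul _ (measurable_weight θ ϑ).ennreal_ofReal hm]
  congr 1
  ext z
  rw [Pi.mul_apply, ← ENNReal.ofReal_mul (weight_nonneg θ ϑ z), weight_add_nat hθ]

theorem memLp_sub_pow_mul_iff {α β θ ϑ : ℝ} (h : Admissible α β θ ϑ) (N : ℕ) {g : ℂ × ℂ → ℂ}
    (hg : ContinuousOn g bidisk) :
    MemLp (fun z => (z.1 - z.2) ^ N * g z) 2 (bidiskMeasure α β θ ϑ) ↔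
      MemLp g 2 (bidiskMeasure α β (θ + N) ϑ) := by
  have hm : Measurable fun z : ℂ × ℂ => ENNReal.ofReal (‖(z.1 - z.2) ^ N‖ ^ 2) := by fun_prop
  rw [memLp_two_iff_integrable_sq_norm (aestronglyMeasurable_bidiskMeasure θ ϑ h.alpha h.beta
      (by fun_prop)), memLp_two_iff_integrable_sq_norm
      (aestronglyMeasurable_bidiskMeasure (θ + N) ϑ h.alpha h.beta hg),
    bidiskMeasure_add_nat α β h.theta, integrable_withDensity_iff_integrable_smul' hm (by simp)]
  refine integrable_congr (Eventually.of_forall fun z => ?_)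
  simp only
  rw [ENNReal.toReal_ofReal (by positivity), norm_mul, mul_pow, smul_eq_mul]

/-- The factor `|z₁ - z₂|^(2N)` produced by the two functions is precisely the change of weight from
`θ` to `θ + N`. -/
theorem inner_eq_of_rep_eq {α β θ ϑ : ℝ} (h : Admissible α β θ ϑ) {N : ℕ}
    {f₁ f₂ : bergmanSpace α β θ ϑ} {g₁ g₂ : bergmanSpace α β (θ + N) ϑ}
    (h₁ : ∀ z ∈ bidisk, rep f₁ z = (z.1 - z.2) ^ N * rep g₁ z)
    (h₂ : ∀ z ∈ bidisk, rep f₂ z = (z.1 - z.2) ^ N * rep g₂ z) :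
    inner ℂ f₁ f₂ = inner ℂ g₁ g₂ := by
  have hm : Measurable fun z : ℂ × ℂ => ENNReal.ofReal (‖(z.1 - z.2) ^ N‖ ^ 2) := by fun_prop
  rw [inner_eq_integral, inner_eq_integral, bidiskMeasure_add_nat α β h.theta,
    integral_withDensity_eq_integral_toReal_smul hm (by simp)]
  refine integral_congr_ae ?_
  filter_upwards [bidiskMeasure_ae_mem α β θ ϑ] with z hz
  rw [h₁ z hz, h₂ z hz, ENNReal.toReal_ofReal (by positivity), Complex.real_smul, map_mul,
    Complex.ofReal_pow, ← Complex.conj_mul']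
  ring

instance {α β θ ϑ : ℝ} [ha : Fact (Admissible α β θ ϑ)] (N : ℕ) :
    Fact (Admissible α β (θ + N) ϑ) := ⟨ha.out.add_nat N⟩

variable {α β θ ϑ : ℝ} [ha : Fact (Admissible α β θ ϑ)]

/-- Multiplication by `(z₁ - z₂) ^ N`. -/
def mulDiag (N : ℕ) (g : bergmanSpace α β (θ + N) ϑ) : bergmanSpace α β θ ϑ :=
  ofFun (fun z => (z.1 - z.2) ^ N * rep g z)
    (((differentiable_fst.sub differentiable_snd).pow N).differentiableOn.mul
      (differentiableOn_rep g))
    ((memLp_sub_pow_mul_iff ha.out N (differentiableOn_rep g).continuousOn).2 (memLp_rep g))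

theorem rep_mulDiag (N : ℕ) (g : bergmanSpace α β (θ + N) ϑ) {z : ℂ × ℂ} (hz : z ∈ bidisk) :
    rep (mulDiag N g) z = (z.1 - z.2) ^ N * rep g z :=
  rep_eqOn (((differentiable_fst.sub differentiable_snd).pow N).differentiableOn.mul
      (differentiableOn_rep g)) (ofFun_ae_eq _ _ _) hz

theorem norm_mulDiag (N : ℕ) (g : bergmanSpace α β (θ + N) ϑ) : ‖mulDiag N g‖ = ‖g‖ := by
  have h := inner_eq_of_rep_eq ha.out (fun z hz => rep_mulDiag N g hz)
    (fun z hz => rep_mulDiag N g hz)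
  have e1 := inner_self_eq_norm_sq_to_K (𝕜 := ℂ) (mulDiag N g)
  have e2 := inner_self_eq_norm_sq_to_K (𝕜 := ℂ) g
  rw [h, e2] at e1
  have e3 : ‖g‖ ^ 2 = ‖mulDiag N g‖ ^ 2 := by
    have e4 : ((‖g‖ : ℂ)) ^ 2 = (‖mulDiag N g‖ : ℂ) ^ 2 := e1
    exact_mod_cast e4
  exact ((pow_left_inj₀ (norm_nonneg _) (norm_nonneg _) two_ne_zero).1 e3).symm

/-! ### The kernel expansion -/

/-- The kernel splits orthogonally. Its part in the complement of `diagSpace` vanishes on the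
diagonal, and dividing it by `z₁ - z₂` must give a multiple of the kernel for `θ + 1`. -/
theorem rep_ker_eq_add_aux (w : bidisk) {z : ℂ × ℂ} (hz : z ∈ bidisk) :
    rep (ker α β θ ϑ w) z = diagTerm α β θ ϑ z w +
      (z.1 - z.2) * conj ((w : ℂ × ℂ).1 - (w : ℂ × ℂ).2) * rep (ker α β (θ + (1 : ℕ)) ϑ w) z := by
  set q := (diagSpace α β θ ϑ).starProjection (ker α β θ ϑ w) with hq
  set r := ker α β θ ϑ w - q with hr
  have hrm : r ∈ (diagSpace α β θ ϑ)ᗮ := Submodule.sub_starProjection_mem_orthogonal _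
  obtain ⟨G, hG, hGr⟩ := exists_eq_sub_mul (differentiableOn_rep r) fun ξ hξ =>
    onDiag_eq_zero_of_mem_orthogonal hrm hξ
  have hGL : MemLp G 2 (bidiskMeasure α β (θ + (1 : ℕ)) ϑ) := by
    refine (memLp_sub_pow_mul_iff ha.out 1 hG.continuousOn).1 ((memLp_congr_ae ?_).1 (memLp_rep r))
    filter_upwards [bidiskMeasure_ae_mem α β θ ϑ] with y hy
    rw [hGr y hy, pow_one]
  set g : bergmanSpace α β (θ + (1 : ℕ)) ϑ := ofFun G hG hGL with hg
  have hgG : EqOn (rep g) G bidisk := rep_eqOn hG (ofFun_ae_eq _ _ _)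
  have hrg : ∀ y ∈ bidisk, rep r y = (y.1 - y.2) ^ 1 * rep g y := fun y hy => by
    rw [hGr y hy, pow_one, hgG hy]
  -- Tested against any `h`: `(z₁ - z₂) h` is orthogonal to `diagSpace`, so pairing it with `r` is
  -- the same as pairing it with the kernel, that is, evaluating it at `w`.
  have hgk : g = conj ((w : ℂ × ℂ).1 - (w : ℂ × ℂ).2) • ker α β (θ + (1 : ℕ)) ϑ w := by
    refine ext_inner_right ℂ fun h => ?_
    have hmem : mulDiag 1 h ∈ (diagSpace α β θ ϑ)ᗮ := by
      refine mem_orthogonal_of_onDiag_eq_zero fun ξ hξ => ?_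
      rw [onDiag, rep_mulDiag 1 h (diag_mem hξ)]
      simp
    have hqm : q ∈ diagSpace α β θ ϑ := Submodule.starProjection_apply_mem _ _
    rw [← inner_eq_of_rep_eq ha.out hrg (fun y hy => rep_mulDiag 1 h hy), hr, inner_sub_left,
      hmem q hqm, inner_ker, rep_mulDiag 1 h w.2]
    have e := inner_smul_left (𝕜 := ℂ) (ker α β (θ + (1 : ℕ)) ϑ w) h
      (conj ((w : ℂ × ℂ).1 - (w : ℂ × ℂ).2))
    refine Eq.trans ?_ e.symm
    rw [inner_ker, Complex.conj_conj]
    ring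
  have h1 : rep r z = rep (ker α β θ ϑ w) z - rep q z := rep_sub _ _ hz
  have h2 : rep g z =
      conj ((w : ℂ × ℂ).1 - (w : ℂ × ℂ).2) * rep (ker α β (θ + (1 : ℕ)) ϑ w) z := by
    rw [hgk]; exact rep_smul _ _ hz
  rw [hrg z hz, h2, hq, rep_starProjection_ker w hz] at h1
  linear_combination -h1

/-- The space itself depends on the real parameter, so `(θ + N) + 1` and `θ + (N + 1 : ℕ)` have to
be exchanged at the level of values. -/
theorem rep_ker_congr {θ₁ θ₂ : ℝ} [Fact (Admissible α β θ₁ ϑ)] [Fact (Admissible α β θ₂ ϑ)]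
    (h : θ₁ = θ₂) (w : bidisk) (z : ℂ × ℂ) :
    rep (ker α β θ₁ ϑ w) z = rep (ker α β θ₂ ϑ w) z := by
  subst h; rfl

theorem rep_ker_eq_add {θ' : ℝ} [Fact (Admissible α β θ' ϑ)] (h : θ' = θ + 1) (w : bidisk)
    {z : ℂ × ℂ} (hz : z ∈ bidisk) :
    rep (ker α β θ ϑ w) z = diagTerm α β θ ϑ z w +
      (z.1 - z.2) * conj ((w : ℂ × ℂ).1 - (w : ℂ × ℂ).2) * rep (ker α β θ' ϑ w) z := by
  rw [rep_ker_eq_add_aux w hz, rep_ker_congr (θ₁ := θ') (θ₂ := θ + (1 : ℕ)) (by rw [h]; simp)]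

/-- The remainder after `N` terms of the kernel expansion. -/
def remainder (α β θ ϑ : ℝ) [Fact (Admissible α β θ ϑ)] (w : bidisk) (z : ℂ × ℂ) (N : ℕ) : ℂ :=
  (z.1 - z.2) ^ N * conj ((w : ℂ × ℂ).1 - (w : ℂ × ℂ).2) ^ N * rep (ker α β (θ + N) ϑ w) z

theorem remainder_zero (w : bidisk) (z : ℂ × ℂ) :
    remainder α β θ ϑ w z 0 = rep (ker α β θ ϑ w) z := by
  rw [remainder, rep_ker_congr (θ₁ := θ + (0 : ℕ)) (θ₂ := θ) (by simp)]
  simp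

theorem remainder_sub_succ (w : bidisk) {z : ℂ × ℂ} (hz : z ∈ bidisk) (N : ℕ) :
    remainder α β θ ϑ w z N - remainder α β θ ϑ w z (N + 1) =
      (z.1 - z.2) ^ N * conj ((w : ℂ × ℂ).1 - (w : ℂ × ℂ).2) ^ N *
        diagTerm α β (θ + N) ϑ z w := by
  have h := rep_ker_eq_add (α := α) (β := β) (ϑ := ϑ) (θ := θ + N) (θ' := θ + (N + 1 : ℕ))
    (by push_cast; ring) w hz
  rw [remainder, remainder, h]
  ring

theorem rep_ker_self (w : bidisk) :
    rep (ker α β θ ϑ w) w = ((‖ker α β θ ϑ w‖ ^ 2 : ℝ) : ℂ) := by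
  rw [← inner_ker]
  have := inner_self_eq_norm_sq_to_K (𝕜 := ℂ) (ker α β θ ϑ w)
  push_cast
  exact this

theorem diagTerm_self (w : ℂ × ℂ) : ∃ c : ℝ, 0 ≤ c ∧ diagTerm α β θ ϑ w w = c := by
  have hσ := sigma_pos ha.out
  refine ⟨sigma α β θ ϑ * ∫ ξ, ‖codiagKer α β θ ϑ w ξ‖ ^ 2 ∂dA (diagExp α β θ ϑ),
    mul_nonneg hσ.le (integral_nonneg fun ξ => by positivity), ?_⟩
  rw [diagTerm, Complex.ofReal_mul, ← integral_complex_ofReal]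
  congr 2
  ext ξ
  rw [Complex.conj_mul']
  push_cast
  rfl

/-- At `z = w` the remainder is the square of the left side, and consecutive remainders differ by a
nonnegative term of the series, so they decrease from `‖ker α β θ ϑ w‖²`. -/
theorem norm_pow_mul_norm_ker_le (w : bidisk) (N : ℕ) :
    ‖(w : ℂ × ℂ).1 - (w : ℂ × ℂ).2‖ ^ N * ‖ker α β (θ + N) ϑ w‖ ≤ ‖ker α β θ ϑ w‖ := by
  set d := (w : ℂ × ℂ).1 - (w : ℂ × ℂ).2 with hd
  have hrem : ∀ N : ℕ, remainder α β θ ϑ w w N =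
      (((‖d‖ ^ N * ‖ker α β (θ + N) ϑ w‖) ^ 2 : ℝ) : ℂ) := by
    intro N
    rw [remainder, rep_ker_self, ← hd, ← mul_pow, Complex.mul_conj']
    push_cast
    ring
  have hanti : Antitone fun N : ℕ => (‖d‖ ^ N * ‖ker α β (θ + N) ϑ w‖) ^ 2 := by
    refine antitone_nat_of_succ_le fun N => ?_
    have h := remainder_sub_succ (α := α) (β := β) (θ := θ) (ϑ := ϑ) w w.2 N
    obtain ⟨c, hc, hcd⟩ := diagTerm_self (α := α) (β := β) (θ := θ + N) (ϑ := ϑ) (w : ℂ × ℂ)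
    rw [hrem, hrem, hcd, ← hd, ← mul_pow, Complex.mul_conj', ← Complex.ofReal_sub,
      ← Complex.ofReal_pow, ← Complex.ofReal_pow, ← Complex.ofReal_mul, Complex.ofReal_inj] at h
    have : 0 ≤ (‖d‖ ^ 2) ^ N * c := by positivity
    linarith
  have h0 := hanti (Nat.zero_le N)
  have e0 := hrem 0
  rw [remainder_zero, rep_ker_self, Complex.ofReal_inj] at e0
  simp only [← e0] at h0
  exact (pow_le_pow_iff_left₀ (by positivity) (norm_nonneg _) two_ne_zero).1 h0

theorem exists_bound_on_compact (α β θ ϑ : ℝ) [Fact (Admissible α β θ ϑ)] {K : Set (ℂ × ℂ)}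
    (hK : IsCompact K) (hKU : K ⊆ bidisk) :
    ∃ C : ℝ, 0 ≤ C ∧ ∀ p ∈ K, ∀ f : bergmanSpace α β θ ϑ, ‖rep f p‖ ≤ C * ‖f‖ := by
  refine hK.induction_on (p := fun s => ∃ C : ℝ, 0 ≤ C ∧ ∀ p ∈ s, ∀ f : bergmanSpace α β θ ϑ,
    ‖rep f p‖ ≤ C * ‖f‖) ⟨0, le_rfl, by simp⟩ ?_ ?_ ?_
  · rintro s t hst ⟨C, hC0, hC⟩
    exact ⟨C, hC0, fun p hp => hC p (hst hp)⟩
  · rintro s t ⟨C, hC0, hC⟩ ⟨D, hD0, hD⟩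
    refine ⟨C + D, by positivity, fun p hp f => ?_⟩
    have hn := norm_nonneg f
    rcases hp with hp | hp
    · have := hC p hp f; nlinarith
    · have := hD p hp f; nlinarith
  · intro p hp
    obtain ⟨ε, hε, C, hC⟩ := exists_local_bound_rep α β θ ϑ (hKU hp)
    exact ⟨ball p ε, mem_nhdsWithin_of_mem_nhds (ball_mem_nhds _ hε), C, C.2,
      fun y hy f => hC f y hy⟩

/-- Functions vanishing to high order on the diagonal are small. -/
theorem exists_decay (α β θ ϑ : ℝ) [Fact (Admissible α β θ ϑ)] {z : ℂ × ℂ} (hz : z ∈ bidisk) :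
    ∃ C ρ : ℝ, 0 ≤ C ∧ 0 ≤ ρ ∧ ρ < 1 ∧ ∀ (N : ℕ) (g : bergmanSpace α β (θ + N) ϑ),
      ‖(z.1 - z.2) ^ N * rep g z‖ ≤ C * ρ ^ N * ‖g‖ := by
  set a := z.2 with ha
  have had : a ∈ disk := hz.2
  set u₀ := mob a z.1 with hu₀
  have hu₀d : ‖u₀‖ < 1 := mob_mem had hz.1
  have hz1 : mob a u₀ = z.1 := mob_mob had hz.1
  -- Any radius strictly between `‖u₀‖` and `1` would do; the ratio `‖u₀‖ / t` is the rate `ρ`.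
  set t := (1 + ‖u₀‖) / 2 with ht
  have ht1 : t < 1 := by rw [ht]; linarith
  have hut : ‖u₀‖ < t := by rw [ht]; linarith
  have ht0 : 0 < t := by rw [ht]; linarith [norm_nonneg u₀]
  have hsub : closedBall (0 : ℂ) t ⊆ disk := fun u hu =>
    lt_of_le_of_lt (mem_closedBall_zero_iff.1 hu) ht1
  have hcont : ContinuousOn (fun u => (mob a u, a)) (closedBall (0 : ℂ) t) :=
    ((differentiableOn_mob had).continuousOn.mono hsub).prodMk continuousOn_const
  have hmaps : ∀ u ∈ disk, (mob a u, a) ∈ bidisk := fun u hu => ⟨mob_mem had hu, had⟩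
  obtain ⟨C, hC0, hC⟩ := exists_bound_on_compact α β θ ϑ
    ((isCompact_closedBall (0 : ℂ) t).image_of_continuousOn hcont)
    (by rintro _ ⟨u, hu, rfl⟩; exact hmaps u (hsub hu))
  refine ⟨C, ‖u₀‖ / t, hC0, by positivity, (div_lt_one ht0).2 hut, fun N g => ?_⟩
  -- On the slice `u ↦ (mob a u, a)` the diagonal is met at `u = 0`, and `h` is what remains after
  -- the zero `u ^ N` is divided out.
  set h : ℂ → ℂ := fun u => (-(defect a : ℂ) / (1 - conj a * u)) ^ N * rep g (mob a u, a) with hh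
  have hfac : ∀ u ∈ disk, (mob a u - a) ^ N * rep g (mob a u, a) = u ^ N * h u := by
    intro u hu
    have e := mob_sub_mob had hu (show (0 : ℂ) ∈ disk by simp [disk])
    rw [mob_zero, mul_zero, sub_zero, mul_one] at e
    rw [hh, e]
    simp only
    rw [← mul_assoc, ← mul_pow]
    congr 2
    ring
  have hdiff : DifferentiableOn ℂ h disk := by
    refine DifferentiableOn.mul (DifferentiableOn.pow (DifferentiableOn.div (by fun_prop)
      (by fun_prop) fun u hu => one_sub_ne_zero had (le_of_lt hu)) N) ?_
    exact (differentiableOn_rep g).comp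
      ((differentiableOn_mob had).prodMk (differentiableOn_const _)) hmaps
  have hbd : ∀ u ∈ frontier (ball (0 : ℂ) t), ‖h u‖ ≤ C * ‖g‖ / t ^ N := by
    intro u hu
    rw [frontier_ball _ ht0.ne', mem_sphere_zero_iff_norm] at hu
    have hud : u ∈ disk := by change ‖u‖ < 1; rw [hu]; exact ht1
    -- Since `mulDiag N` maps isometrically into the fixed space with parameter `θ`, the constant
    -- `C` does not depend on `N`.
    have h1 := hC _ ⟨u, mem_closedBall_zero_iff.2 hu.le, rfl⟩ (mulDiag N g)
    rw [rep_mulDiag N g (hmaps u hud), hfac u hud, norm_mul, norm_pow, hu, norm_mulDiag] at h1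
    rw [le_div_iff₀ (by positivity)]
    linarith
  have hmax := Complex.norm_le_of_forall_mem_frontier_norm_le isBounded_ball
    (hdiff.diffContOnCl_ball (c := (0 : ℂ)) (R := t) hsub) hbd
    (subset_closure (mem_ball_zero_iff.2 hut))
  have hpt : (mob a u₀, a) = z := Prod.ext hz1 rfl
  have e := hfac u₀ hu₀d
  rw [hpt, hz1] at e
  rw [e, norm_mul, norm_pow, div_pow]
  calc ‖u₀‖ ^ N * ‖h u₀‖ ≤ ‖u₀‖ ^ N * (C * ‖g‖ / t ^ N) := by gcongr
    _ = _ := by ring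

theorem exists_remainder_le (w : bidisk) {z : ℂ × ℂ} (hz : z ∈ bidisk) :
    ∃ C ρ : ℝ, 0 ≤ ρ ∧ ρ < 1 ∧ ∀ N : ℕ, ‖remainder α β θ ϑ w z N‖ ≤ C * ρ ^ N := by
  obtain ⟨C, ρ, hC, hρ0, hρ1, h⟩ := exists_decay α β θ ϑ hz
  refine ⟨C * ‖ker α β θ ϑ w‖, ρ, hρ0, hρ1, fun N => ?_⟩
  have h1 := h N (ker α β (θ + N) ϑ w)
  have h2 := norm_pow_mul_norm_ker_le (α := α) (β := β) (θ := θ) (ϑ := ϑ) w N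
  have e : remainder α β θ ϑ w z N = conj ((w : ℂ × ℂ).1 - (w : ℂ × ℂ).2) ^ N *
      ((z.1 - z.2) ^ N * rep (ker α β (θ + N) ϑ w) z) := by
    rw [remainder]; ring
  rw [e, norm_mul, norm_pow, RCLike.norm_conj]
  calc _ ≤ ‖(w : ℂ × ℂ).1 - (w : ℂ × ℂ).2‖ ^ N * (C * ρ ^ N * ‖ker α β (θ + N) ϑ w‖) := by gcongr
    _ = C * ρ ^ N * (‖(w : ℂ × ℂ).1 - (w : ℂ × ℂ).2‖ ^ N * ‖ker α β (θ + N) ϑ w‖) := by ring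
    _ ≤ C * ρ ^ N * ‖ker α β θ ϑ w‖ := by gcongr
    _ = _ := by ring

theorem kernelTerm_eq (w : bidisk) {z : ℂ × ℂ} (hz : z ∈ bidisk) (N : ℕ) :
    kernelTerm α β θ ϑ N z w =
      remainder α β θ ϑ w z N - remainder α β θ ϑ w z (N + 1) := by
  have hexp : α + β + 2 * θ + 2 * ϑ + 2 * N + 2 = diagExp α β (θ + N) ϑ := by
    rw [diagExp]; ring
  have hint : ∫ ξ, kernelIntegrand α β θ ϑ N z w ξ ∂dA (diagExp α β (θ + N) ϑ) =
      ∫ ξ, conj (codiagKer α β (θ + N) ϑ z ξ) * codiagKer α β (θ + N) ϑ w ξ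
        ∂dA (diagExp α β (θ + N) ϑ) := by
    refine integral_congr_ae ?_
    filter_upwards [dA_ae_mem _] with ξ hξ using kernelIntegrand_eq N hz w.2 hξ
  rw [remainder_sub_succ w hz, kernelTerm, hexp, hint, diagTerm, map_sub]
  ring

/-- The terms are differences of consecutive remainders, so the partial sums telescope; geometric
decay of the remainders gives both summability and the limit. -/
theorem hasSum_kernelTerm (w : bidisk) {z : ℂ × ℂ} (hz : z ∈ bidisk) :
    HasSum (fun N : ℕ => kernelTerm α β θ ϑ N z w) (rep (ker α β θ ϑ w) z) := by
  obtain ⟨C, ρ, hρ0, hρ1, hle⟩ := exists_remainder_le (α := α) (β := β) (θ := θ) (ϑ := ϑ) w hz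
  have hgeo : Summable fun N : ℕ => C * ρ ^ N := (summable_geometric_of_lt_one hρ0 hρ1).mul_left C
  have hs1 : Summable fun N => remainder α β θ ϑ w z N := Summable.of_norm_bounded hgeo hle
  have hs2 := (summable_nat_add_iff 1).2 hs1
  have hs : Summable fun N : ℕ => kernelTerm α β θ ϑ N z w := by
    simp only [kernelTerm_eq w hz]
    exact hs1.sub hs2
  rw [hs.hasSum_iff_tendsto_nat]
  have h0 := (hs1.tendsto_atTop_zero).const_sub (remainder α β θ ϑ w z 0)
  rw [sub_zero, remainder_zero] at h0
  refine h0.congr fun n => ?_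
  simp only [kernelTerm_eq w hz]
  rw [Finset.sum_range_sub', remainder_zero]

end BidiskBergman
end

/-! ### The main theorem. -/

theorem mainTheorem2 (α β θ ϑ : ℝ) (hα : -1 < α) (hβ : -1 < β) (hθ : -1 < θ) (hϑ : -1 < ϑ)
    (hsum : 0 < α + β + 2 * θ + 2 * ϑ + 3) :
    (∀ N : ℕ, Integrable (BidiskBergman.weight (θ + N) ϑ)
        ((BidiskBergman.dA α).prod (BidiskBergman.dA β)) ∧
      0 < BidiskBergman.sigma α β (θ + N) ϑ) ∧
    (∀ N : ℕ, ∀ z ∈ BidiskBergman.bidisk, ∀ w ∈ BidiskBergman.bidisk,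
      Integrable (BidiskBergman.kernelIntegrand α β θ ϑ N z w)
        (BidiskBergman.dA (α + β + 2 * θ + 2 * ϑ + 2 * N + 2))) ∧
    ∃ (_ : CompleteSpace (BidiskBergman.bergmanSpace α β θ ϑ))
      (_ : RKHS ℂ (BidiskBergman.bergmanSpace α β θ ϑ) BidiskBergman.bidisk ℂ),
      -- the value of an element at a point is the value of its holomorphic representative
      (∀ (f : BidiskBergman.bergmanSpace α β θ ϑ) (g : ℂ × ℂ → ℂ),
        DifferentiableOn ℂ g BidiskBergman.bidisk →
        (f : Lp ℂ 2 (BidiskBergman.bidiskMeasure α β θ ϑ))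
          =ᵐ[BidiskBergman.bidiskMeasure α β θ ϑ] g →
        ∀ z : BidiskBergman.bidisk, RKHS.coeCLM ℂ f z = g z) ∧
      ∀ z w : BidiskBergman.bidisk,
        HasSum (fun N : ℕ => BidiskBergman.kernelTerm α β θ ϑ N z w)
          (RKHS.kernel (BidiskBergman.bergmanSpace α β θ ϑ) z w 1) := by
  have h : BidiskBergman.Admissible α β θ ϑ := ⟨hα, hβ, hθ, hϑ, hsum⟩
  have : Fact (BidiskBergman.Admissible α β θ ϑ) := ⟨h⟩
  refine ⟨fun N => ⟨BidiskBergman.integrable_weight (h.add_nat N),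
    BidiskBergman.sigma_pos (h.add_nat N)⟩, fun N z hz w hw => ?_, inferInstance, inferInstance,
    fun f g hg hfg z => BidiskBergman.rep_eqOn hg hfg z.2, fun z w => ?_⟩
  · have hs := (h.add_nat N).diagExp_gt
    have hexp : BidiskBergman.diagExp α β (θ + N) ϑ =
        α + β + 2 * θ + 2 * ϑ + 2 * N + 2 := by
      rw [BidiskBergman.diagExp]; ring
    rw [hexp] at hs
    exact memLp_one_iff_integrable.1 (BidiskBergman.memLp_kernelIntegrand hs N hz hw 1)
  · rw [BidiskBergman.kernel_eq_rep_ker]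
    exact BidiskBergman.hasSum_kernelTerm w z.2
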